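/- Let $k$ be a field, $A$ an associative unital $k$-algebra, $B$ a commutative unital $k$-algebra, and $\varepsilon:B\to A$ a morphism of $k$-algebras whose image lies in the center of $A$. For $n\ge 0$ let $$C^n=C^n((A,B,\varepsilon);A)=\mathrm{Hom}_k\bigl(A^{\otimes n}\otimes B^{\otimes n(n-1)/2},A\bigr),$$ and write a pure tensor in $A^{\otimes n}\otimes B^{\otimes n(n-1)/2}$ as an upper triangular matrix $T$ with diagonal entries $a_i\in A$ ($1\le i\le n$) and entries $b_{i,j}\in B$ ($1\le i<j\le n$) above the diagonal. For $0\le p\le q\le n$ let $T^p_q$ be the submatrix on the rows and columns $p+1,\dots,q$. For $T$ of size $n+1$ and $1\le i\le n$ let $M_{i,i+1}$ be the matrix of size $n$ obtained from $T$ by merging the rows $i,i+1$ and the columns $i,i+1$: the $i$-th diagonal entry becomes $\varepsilon(b_{i,i+1})a_ia_{i+1}$, the entries above it become $b_{l,i}b_{l,i+1}$ $(l<i)$, the entries to the right of it become $b_{i,j}b_{i+1,j}$ $(j>i+1)$, and all other entries are unchanged. The differential $\delta^\varepsilon_n:C^n\to C^{n+1}$ is $$\delta^\varepsilon_n(f)(T)=a_1\,\varepsilon\Bigl(\prod_{j=2}^{n+1}b_{1,j}\Bigr)f(T^1_{n+1})+\sum_{i=1}^n(-1)^i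 f(M_{i,i+1})+(-1)^{n+1}f(T^0_n)\,a_{n+1}\,\varepsilon\Bigl(\prod_{i=1}^{n}b_{i,n+1}\Bigr),$$ and the secondary Hochschild cohomology $H^n((A,B,\varepsilon);A)$ is $\ker\delta^\varepsilon_n/\mathrm{im}\,\delta^\varepsilon_{n-1}$ (with $\mathrm{im}\,\delta^\varepsilon_{-1}=0$). The cup product of $f\in C^m$ and $g\in C^n$ is the cochain $f\smile g\in C^{m+n}$ with $$(f\smile g)(T)=f(T^0_m)\;\varepsilon\Bigl(\prod_{\substack{1\le i\le m\\ m+1\le j\le m+n}}b_{i,j}\Bigr)\;g(T^m_{m+n}).$$ It induces a product on cohomology by $[f]\smile[g]=[f\smile g]$, and, extended bilinearly, a product on $H^*((A,B,\varepsilon);A)=\bigoplus_{n\ge0}H^n((A,B,\varepsilon);A)$. Then this cup product is graded commutative: for all $m,n\ge 0$, $x\in H^m((A,B,\varepsilon);A)$ and $y\in H^n((A,B,\varepsilon);A)$, $$x\smile y=(-1)^{mn}\,y\smile x .$$ -/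

import Mathlib

open scoped TensorProduct DirectSum

noncomputable section

namespace SecondaryHochschild

/-- The positions strictly above the diagonal of an `n × n` matrix (there are `n(n-1)/2`). -/
abbrev Pair (n : ℕ) : Type := {p : Fin n × Fin n // p.1 < p.2}

/-- The position `(i, j)`, for `i < j`. -/
abbrev pr {n : ℕ} (i j : Fin n) (h : i < j) : Pair n := ⟨(i, j), h⟩

theorem castAdd_lt_natAdd {m n : ℕ} (i : Fin m) (j : Fin n) :
    Fin.castAdd n i < Fin.natAdd m j := by
  rw [Fin.lt_def, Fin.val_castAdd, Fin.val_natAdd]; omega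

theorem strictMono_castAdd {m : ℕ} (n : ℕ) : StrictMono (Fin.castAdd n : Fin m → Fin (m + n)) :=
  fun _ _ h => h

/-- The image of a position under a strictly monotone map of indices. -/
def Pair.map {m n : ℕ} (φ : Fin m → Fin n) (hφ : StrictMono φ) (p : Pair m) : Pair n :=
  ⟨(φ p.1.1, φ p.1.2), hφ p.2⟩

section Cochains

variable (k A B : Type*) [CommRing k] [Ring A] [Algebra k A] [CommRing B] [Algebra k B]

/-- The `n`-cochains `Hom_k(A^{⊗ n} ⊗ B^{⊗ n(n-1)/2}, A)`. The factors `B` are indexed by the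
positions above the diagonal. -/
def Cochain (n : ℕ) : Type _ :=
  ((⨂[k] _ : Fin n, A) ⊗[k] (⨂[k] _ : Pair n, B)) →ₗ[k] A

instance (n : ℕ) : AddCommGroup (Cochain k A B n) :=
  inferInstanceAs (AddCommGroup (((⨂[k] _ : Fin n, A) ⊗[k] (⨂[k] _ : Pair n, B)) →ₗ[k] A))

instance (n : ℕ) : Module k (Cochain k A B n) :=
  inferInstanceAs (Module k (((⨂[k] _ : Fin n, A) ⊗[k] (⨂[k] _ : Pair n, B)) →ₗ[k] A))

/-- A cochain as a linear map on the tensor product. -/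
def Cochain.toLin {k A B : Type*} [CommRing k] [Ring A] [Algebra k A] [CommRing B] [Algebra k B]
    {n : ℕ} (f : Cochain k A B n) :
    ((⨂[k] _ : Fin n, A) ⊗[k] (⨂[k] _ : Pair n, B)) →ₗ[k] A := f

variable {k A B}

/-- The value of a cochain on the pure tensor with diagonal entries `a i` and entries `b (i, j)`
above the diagonal. -/
def ev {n : ℕ} (f : Cochain k A B n) (a : Fin n → A) (b : Pair n → B) : A :=
  f.toLin (PiTensorProduct.tprod k a ⊗ₜ[k] PiTensorProduct.tprod k b)

theorem ev_ext {n : ℕ} {f g : Cochain k A B n} (h : ∀ a b, ev f a b = ev g a b) : f = g := by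
  apply TensorProduct.ext
  apply PiTensorProduct.ext
  ext a : 1
  apply PiTensorProduct.ext
  ext b
  exact h a b

@[simp] theorem ev_add {n : ℕ} (f g : Cochain k A B n) (a b) :
    ev (f + g) a b = ev f a b + ev g a b := rfl

@[simp] theorem ev_smul {n : ℕ} (c : k) (f : Cochain k A B n) (a b) :
    ev (c • f) a b = c • ev f a b := rfl

@[simp] theorem ev_zero {n : ℕ} (a b) : ev (0 : Cochain k A B n) a b = 0 := rfl

/-- `F` is `k`-linear in each entry of the tensor matrix separately. -/
structure IsMultilinear (k : Type*) {A B : Type*} [CommRing k] [Ring A] [Algebra k A]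
    [CommRing B] [Algebra k B] {n : ℕ} (F : (Fin n → A) → (Pair n → B) → A) : Prop where
  left : ∀ a b i, ∃ L : A →ₗ[k] A, ∀ x, F (Function.update a i x) b = L x
  right : ∀ a b r, ∃ L : B →ₗ[k] A, ∀ x, F a (Function.update b r x) = L x

theorem isMultilinear_ev {n : ℕ} (f : Cochain k A B n) : IsMultilinear k (ev f) where
  left a b i := ⟨(f.toLin ∘ₗ (TensorProduct.mk k _ _).flip (PiTensorProduct.tprod k b)) ∘ₗ
      (PiTensorProduct.tprod k).toLinearMap a i, fun _ => rfl⟩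
  right a b r := ⟨(f.toLin ∘ₗ TensorProduct.mk k _ _ (PiTensorProduct.tprod k a)) ∘ₗ
      (PiTensorProduct.tprod k).toLinearMap b r, fun _ => rfl⟩

/-- The cochain determined by a multilinear function of the entries. -/
def mk {n : ℕ} (F : (Fin n → A) → (Pair n → B) → A) (hF : IsMultilinear k F) :
    Cochain k A B n :=
  TensorProduct.lift <| PiTensorProduct.lift
    { toFun := fun a => PiTensorProduct.lift
        { toFun := fun b => F a b
          map_update_add' := by
            intro inst b r x y
            obtain rfl : inst = Subtype.instDecidableEq := Subsingleton.elim _ _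
            obtain ⟨L, hL⟩ := hF.right a b r
            exact (hL _).trans ((map_add L x y).trans (congrArg₂ _ (hL x).symm (hL y).symm))
          map_update_smul' := by
            intro inst b r c x
            obtain rfl : inst = Subtype.instDecidableEq := Subsingleton.elim _ _
            obtain ⟨L, hL⟩ := hF.right a b r
            exact (hL _).trans ((map_smul L c x).trans (congrArg _ (hL x).symm)) }
      map_update_add' := by
        intro inst a i x y
        obtain rfl : inst = instDecidableEqFin n := Subsingleton.elim _ _
        ext b
        obtain ⟨L, hL⟩ := hF.left a b i
        simpa using
          (hL _).trans ((map_add L x y).trans (congrArg₂ _ (hL x).symm (hL y).symm))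
      map_update_smul' := by
        intro inst a i c x
        obtain rfl : inst = instDecidableEqFin n := Subsingleton.elim _ _
        ext b
        obtain ⟨L, hL⟩ := hF.left a b i
        simpa using (hL _).trans ((map_smul L c x).trans (congrArg _ (hL x).symm)) }

@[simp] theorem ev_mk {n : ℕ} (F : (Fin n → A) → (Pair n → B) → A) (hF : IsMultilinear k F)
    (a b) : ev (mk F hF) a b = F a b := by
  simp [ev, mk, Cochain.toLin]

namespace IsMultilinear

variable {n : ℕ} {F G : (Fin n → A) → (Pair n → B) → A}

theorem add (hF : IsMultilinear k F) (hG : IsMultilinear k G) :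
    IsMultilinear k (fun a b => F a b + G a b) where
  left a b i := by
    obtain ⟨L, hL⟩ := hF.left a b i
    obtain ⟨M, hM⟩ := hG.left a b i
    exact ⟨L + M, fun x => by simp [hL, hM]⟩
  right a b i := by
    obtain ⟨L, hL⟩ := hF.right a b i
    obtain ⟨M, hM⟩ := hG.right a b i
    exact ⟨L + M, fun x => by simp [hL, hM]⟩

theorem smul (c : k) (hF : IsMultilinear k F) : IsMultilinear k (fun a b => c • F a b) where
  left a b i := by
    obtain ⟨L, hL⟩ := hF.left a b i
    exact ⟨c • L, fun x => by simp [hL]⟩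
  right a b i := by
    obtain ⟨L, hL⟩ := hF.right a b i
    exact ⟨c • L, fun x => by simp [hL]⟩

theorem sum {ι : Type*} (s : Finset ι) {F : ι → (Fin n → A) → (Pair n → B) → A}
    (hF : ∀ i, IsMultilinear k (F i)) : IsMultilinear k (fun a b => ∑ i ∈ s, F i a b) where
  left a b i := by
    choose L hL using fun j => (hF j).left a b i
    exact ⟨∑ j ∈ s, L j, fun x => by simp [hL]⟩
  right a b i := by
    choose L hL using fun j => (hF j).right a b i
    exact ⟨∑ j ∈ s, L j, fun x => by simp [hL]⟩

end IsMultilinear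

end Cochains

section Complex

variable {k A B : Type*} [CommRing k] [Ring A] [Algebra k A] [CommRing B] [Algebra k B]
  (ε : B →ₐ[k] A)

/-- The diagonal of the matrix obtained by merging the rows and columns `i` and `i + 1`:
the `i`-th entry is `ε(b_{i,i+1}) a_i a_{i+1}`. -/
def mergeDiag {n : ℕ} (i : Fin n) (a : Fin (n + 1) → A) (b : Pair (n + 1) → B) : Fin n → A :=
  fun j =>
    if j < i then a j.castSucc
    else if j = i then
      ε (b (pr i.castSucc i.succ i.castSucc_lt_succ)) * a i.castSucc * a i.succ
    else a j.succ

/-- The part above the diagonal of the matrix obtained by merging the rows and columns `i` and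
`i + 1`. The map `i.predAbove` sends both `i` and `i + 1` to `i`, and is otherwise the monotone
bijection; the entry at `(p, q)` is the product of all entries at positions over `(p, q)`. -/
def mergeUpper {n : ℕ} (i : Fin n) (b : Pair (n + 1) → B) : Pair n → B :=
  fun p => ∏ r : Pair (n + 1) with
    i.predAbove r.1.1 = p.1.1 ∧ i.predAbove r.1.2 = p.1.2, b r

/-- The first term of the differential, `a_1 ε(b_{1,2} ⋯ b_{1,n+1}) f(T^1_{n+1})`. -/
def firstTerm {n : ℕ} (f : Cochain k A B n) (a : Fin (n + 1) → A) (b : Pair (n + 1) → B) : A :=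
  a 0 * ε (∏ j : Fin n, b (pr 0 j.succ j.succ_pos)) *
    ev f (fun i => a i.succ) (fun p => b (p.map Fin.succ Fin.strictMono_succ))

/-- The last term of the differential (without sign),
`f(T^0_n) a_{n+1} ε(b_{1,n+1} ⋯ b_{n,n+1})`. -/
def lastTerm {n : ℕ} (f : Cochain k A B n) (a : Fin (n + 1) → A) (b : Pair (n + 1) → B) : A :=
  ev f (fun i => a i.castSucc) (fun p => b (p.map Fin.castSucc Fin.strictMono_castSucc)) *
    a (Fin.last n) * ε (∏ i : Fin n, b (pr i.castSucc (Fin.last n) i.castSucc_lt_last))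

/-- The differential on a tensor matrix; indices start at `0`, so that the sign of the term in
which the rows and columns `i` and `i + 1` are merged is `(-1)^(i+1)`. -/
def dFun {n : ℕ} (f : Cochain k A B n) (a : Fin (n + 1) → A) (b : Pair (n + 1) → B) : A :=
  firstTerm ε f a b
    + ∑ i : Fin n, (-1 : k) ^ ((i : ℕ) + 1) • ev f (mergeDiag ε i a b) (mergeUpper i b)
    + (-1 : k) ^ (n + 1) • lastTerm ε f a b

/-- The cup product on a tensor matrix,
`f(T^0_m) (∏_{i ≤ m < j} ε(b_{i,j})) g(T^m_{m+n})`. -/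
def cupFun {m n : ℕ} (f : Cochain k A B m) (g : Cochain k A B n)
    (a : Fin (m + n) → A) (b : Pair (m + n) → B) : A :=
  ev f (fun i => a (Fin.castAdd n i)) (fun p => b (p.map (Fin.castAdd n)
      (strictMono_castAdd n))) *
    ε (∏ ij : Fin m × Fin n, b (pr (Fin.castAdd n ij.1) (Fin.natAdd m ij.2)
      (castAdd_lt_natAdd ij.1 ij.2))) *
    ev g (fun i => a (Fin.natAdd m i)) (fun p => b (p.map (Fin.natAdd m)
      (Fin.strictMono_natAdd m)))

/-! Multilinearity of the terms above. -/

theorem comp_update_of_injective {ι κ R : Type*} [DecidableEq ι] [DecidableEq κ] {φ : ι → κ}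
    (hφ : Function.Injective φ) (a : κ → R) (j : ι) (x : R) :
    (fun i => Function.update a (φ j) x (φ i)) = Function.update (fun i => a (φ i)) j x :=
  Function.update_comp_eq_of_injective a hφ j x

theorem comp_update_of_notMem {ι κ R : Type*} [DecidableEq κ] {φ : ι → κ}
    (a : κ → R) {r : κ} (hr : ∀ i, φ i ≠ r) (x : R) :
    (fun i => Function.update a r x (φ i)) = fun i => a (φ i) :=
  funext fun i => Function.update_of_ne (hr i) _ _

theorem prod_comp_update {ι κ : Type*} [Fintype ι] [DecidableEq ι] [DecidableEq κ] {φ : ι → κ}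
    (hφ : Function.Injective φ) (b : κ → B) (j : ι) :
    ∃ c : B, ∀ x, ∏ i, Function.update b (φ j) x (φ i) = x * c := by
  refine ⟨∏ i ∈ Finset.univ \ {j}, b (φ i), fun x => ?_⟩
  rw [comp_update_of_injective hφ, Finset.prod_update_of_mem (Finset.mem_univ j)]

theorem Pair.map_injective {m n : ℕ} {φ : Fin m → Fin n} (hφ : StrictMono φ) :
    Function.Injective (Pair.map φ hφ) := by
  intro p q h
  simp only [Pair.map, Subtype.mk.injEq, Prod.mk.injEq, hφ.injective.eq_iff] at h
  exact Subtype.ext (Prod.ext h.1 h.2)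

theorem isMultilinear_firstTerm {n : ℕ} (f : Cochain k A B n) :
    IsMultilinear k (firstTerm ε f) where
  left a b i := by
    unfold firstTerm
    induction i using Fin.cases with
    | zero =>
      refine ⟨LinearMap.mulRight k (ε (∏ j : Fin n, b (pr 0 j.succ j.succ_pos)) *
        ev f (fun i => a i.succ) (fun p => b (p.map Fin.succ Fin.strictMono_succ))),
        fun x => ?_⟩
      rw [comp_update_of_notMem _ (fun i => Fin.succ_ne_zero i)]
      simp [mul_assoc]
    | succ i =>
      obtain ⟨L, hL⟩ := (isMultilinear_ev f).left (fun i => a i.succ)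
        (fun p => b (p.map Fin.succ Fin.strictMono_succ)) i
      refine ⟨LinearMap.mulLeft k (a 0 * ε (∏ j : Fin n, b (pr 0 j.succ j.succ_pos))) ∘ₗ L,
        fun x => ?_⟩
      rw [comp_update_of_injective (Fin.succ_injective n), hL,
        Function.update_of_ne (Fin.succ_ne_zero i).symm]
      simp [mul_assoc]
  right a b r := by
    unfold firstTerm
    obtain ⟨⟨p, q⟩, h⟩ := r
    obtain ⟨q, rfl⟩ := Fin.exists_succ_eq.2 (ne_of_gt (lt_of_le_of_lt (Fin.zero_le p) h))
    induction p using Fin.cases with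
    | zero =>
      obtain ⟨c, hc⟩ := prod_comp_update (φ := fun j : Fin n => pr 0 j.succ j.succ_pos)
        (fun i j hij => by simpa using hij) b q
      refine ⟨LinearMap.mulLeft k (a 0) ∘ₗ LinearMap.mulRight k (ε c *
        ev f (fun i => a i.succ) (fun p => b (p.map Fin.succ Fin.strictMono_succ))) ∘ₗ
        ε.toLinearMap, fun x => ?_⟩
      rw [hc, comp_update_of_notMem]
      · simp [mul_assoc]
      · intro p hp
        simp [Pair.map] at hp
    | succ p =>
      have hpq : p < q := Fin.succ_lt_succ_iff.1 h
      obtain ⟨L, hL⟩ := (isMultilinear_ev f).right (fun i => a i.succ)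
        (fun p => b (p.map Fin.succ Fin.strictMono_succ)) (pr p q hpq)
      refine ⟨LinearMap.mulLeft k (a 0 * ε (∏ j : Fin n, b (pr 0 j.succ j.succ_pos))) ∘ₗ L,
        fun x => ?_⟩
      have h1 := comp_update_of_injective (Pair.map_injective Fin.strictMono_succ) b
        (pr p q hpq) x
      have h2 := comp_update_of_notMem (φ := fun j : Fin n => pr 0 j.succ j.succ_pos) b
        (r := pr p.succ q.succ h) (fun i hi => by simp [Fin.ext_iff] at hi) x
      have h2' := congrArg (fun u : Fin n → B => ∏ i, u i) h2
      change _ * ε (∏ j : Fin n, Function.update b (pr p.succ q.succ h) x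
        (pr 0 j.succ j.succ_pos)) * ev f _ (fun i => Function.update b
        (Pair.map Fin.succ Fin.strictMono_succ (pr p q hpq)) x _) = _
      rw [h1, hL, h2']
      simp [mul_assoc]

theorem isMultilinear_lastTerm {n : ℕ} (f : Cochain k A B n) :
    IsMultilinear k (lastTerm ε f) where
  left a b i := by
    unfold lastTerm
    induction i using Fin.lastCases with
    | last =>
      refine ⟨LinearMap.mulLeft k (ev f (fun i => a i.castSucc)
        (fun p => b (p.map Fin.castSucc Fin.strictMono_castSucc))) ∘ₗ LinearMap.mulRight k
        (ε (∏ i : Fin n, b (pr i.castSucc (Fin.last n) i.castSucc_lt_last))), fun x => ?_⟩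
      rw [comp_update_of_notMem _ (fun i => (Fin.castSucc_lt_last i).ne)]
      simp [mul_assoc]
    | cast i =>
      obtain ⟨L, hL⟩ := (isMultilinear_ev f).left (fun i => a i.castSucc)
        (fun p => b (p.map Fin.castSucc Fin.strictMono_castSucc)) i
      refine ⟨LinearMap.mulRight k (a (Fin.last n) *
        ε (∏ i : Fin n, b (pr i.castSucc (Fin.last n) i.castSucc_lt_last))) ∘ₗ L, fun x => ?_⟩
      rw [comp_update_of_injective (Fin.castSucc_injective n), hL,
        Function.update_of_ne (Fin.castSucc_lt_last i).ne']
      simp [mul_assoc]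
  right a b r := by
    unfold lastTerm
    obtain ⟨⟨p, q⟩, h⟩ := r
    obtain ⟨p, rfl⟩ := Fin.exists_castSucc_eq.2 (ne_of_lt (lt_of_lt_of_le h (Fin.le_last q)))
    induction q using Fin.lastCases with
    | last =>
      obtain ⟨c, hc⟩ := prod_comp_update
        (φ := fun i : Fin n => pr i.castSucc (Fin.last n) i.castSucc_lt_last)
        (fun i j hij => by simpa using hij) b p
      refine ⟨LinearMap.mulLeft k (ev f (fun i => a i.castSucc)
        (fun p => b (p.map Fin.castSucc Fin.strictMono_castSucc)) * a (Fin.last n)) ∘ₗ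
        LinearMap.mulRight k (ε c) ∘ₗ ε.toLinearMap, fun x => ?_⟩
      rw [hc, comp_update_of_notMem]
      · simp [mul_assoc]
      · intro p hp
        simp [Pair.map, (Fin.castSucc_lt_last _).ne] at hp
    | cast q =>
      have hpq : p < q := h
      obtain ⟨L, hL⟩ := (isMultilinear_ev f).right (fun i => a i.castSucc)
        (fun p => b (p.map Fin.castSucc Fin.strictMono_castSucc)) (pr p q hpq)
      refine ⟨LinearMap.mulRight k (a (Fin.last n) *
        ε (∏ i : Fin n, b (pr i.castSucc (Fin.last n) i.castSucc_lt_last))) ∘ₗ L, fun x => ?_⟩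
      have h1 := comp_update_of_injective (Pair.map_injective Fin.strictMono_castSucc) b
        (pr p q hpq) x
      have h2 := comp_update_of_notMem
        (φ := fun i : Fin n => pr i.castSucc (Fin.last n) i.castSucc_lt_last) b
        (r := pr p.castSucc q.castSucc h)
        (fun i hi => by simp [(Fin.castSucc_lt_last _).ne'] at hi) x
      have h2' := congrArg (fun u : Fin n → B => ∏ i, u i) h2
      change ev f _ (fun i => Function.update b
        (Pair.map Fin.castSucc Fin.strictMono_castSucc (pr p q hpq)) x _) * _ *
        ε (∏ i : Fin n, Function.update b (pr p.castSucc q.castSucc h) x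
        (pr i.castSucc (Fin.last n) i.castSucc_lt_last)) = _
      rw [h1, hL, h2']
      simp [mul_assoc]

theorem isMultilinear_cupFun {m n : ℕ} (f : Cochain k A B m) (g : Cochain k A B n) :
    IsMultilinear k (cupFun ε f g) where
  left a b i := by
    unfold cupFun
    set c := ε (∏ ij : Fin m × Fin n, b (pr (Fin.castAdd n ij.1) (Fin.natAdd m ij.2)
      (castAdd_lt_natAdd ij.1 ij.2)))
    induction i using Fin.addCases with
    | left i =>
      obtain ⟨L, hL⟩ := (isMultilinear_ev f).left (fun i => a (Fin.castAdd n i))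
        (fun p => b (p.map (Fin.castAdd n) (strictMono_castAdd n))) i
      refine ⟨LinearMap.mulRight k (c * ev g (fun i => a (Fin.natAdd m i))
        (fun p => b (p.map (Fin.natAdd m) (Fin.strictMono_natAdd m)))) ∘ₗ L, fun x => ?_⟩
      rw [comp_update_of_injective (strictMono_castAdd n).injective, hL,
        comp_update_of_notMem _ (fun j => (castAdd_lt_natAdd i j).ne')]
      simp [mul_assoc]
    | right i =>
      obtain ⟨L, hL⟩ := (isMultilinear_ev g).left (fun i => a (Fin.natAdd m i))
        (fun p => b (p.map (Fin.natAdd m) (Fin.strictMono_natAdd m))) i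
      refine ⟨LinearMap.mulLeft k (ev f (fun i => a (Fin.castAdd n i))
        (fun p => b (p.map (Fin.castAdd n) (strictMono_castAdd n))) * c) ∘ₗ L,
        fun x => ?_⟩
      rw [comp_update_of_injective (Fin.strictMono_natAdd m).injective, hL,
        comp_update_of_notMem _ (fun j => (castAdd_lt_natAdd j i).ne)]
      simp [mul_assoc]
  right a b r := by
    unfold cupFun
    obtain ⟨⟨p, q⟩, h⟩ := r
    set φ : Fin m × Fin n → Pair (m + n) := fun ij => pr (Fin.castAdd n ij.1)
      (Fin.natAdd m ij.2) (castAdd_lt_natAdd ij.1 ij.2) with hφ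
    have hφi : Function.Injective φ := by
      intro x y hxy
      simp only [hφ, pr, Subtype.mk.injEq, Prod.mk.injEq,
        (strictMono_castAdd n).injective.eq_iff,
        (Fin.strictMono_natAdd m).injective.eq_iff] at hxy
      exact Prod.ext hxy.1 hxy.2
    induction p using Fin.addCases with
    | left p =>
      induction q using Fin.addCases with
      | left q =>
        have hpq : p < q := h
        obtain ⟨L, hL⟩ := (isMultilinear_ev f).right (fun i => a (Fin.castAdd n i))
          (fun p => b (p.map (Fin.castAdd n) (strictMono_castAdd n))) (pr p q hpq)
        refine ⟨LinearMap.mulRight k (ε (∏ ij, b (φ ij)) * ev g (fun i => a (Fin.natAdd m i))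
          (fun p => b (p.map (Fin.natAdd m) (Fin.strictMono_natAdd m)))) ∘ₗ L, fun x => ?_⟩
        have h1 := comp_update_of_injective (Pair.map_injective (strictMono_castAdd n)) b
          (pr p q hpq) x
        have h2 := comp_update_of_notMem (φ := φ) b
          (r := Pair.map (Fin.castAdd n) (strictMono_castAdd n) (pr p q hpq))
          (fun i hi => (castAdd_lt_natAdd q i.2).ne'
            (congrArg (fun r : Pair (m + n) => r.1.2) hi)) x
        have h2' := congrArg (fun u : Fin m × Fin n → B => ∏ i, u i) h2
        have h3 := comp_update_of_notMem
          (φ := Pair.map (Fin.natAdd m) (Fin.strictMono_natAdd m)) b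
          (r := Pair.map (Fin.castAdd n) (strictMono_castAdd n) (pr p q hpq))
          (fun i hi => (castAdd_lt_natAdd p i.1.1).ne'
            (congrArg (fun r : Pair (m + n) => r.1.1) hi)) x
        change ev f _ (fun i => Function.update b
          (Pair.map (Fin.castAdd n) (strictMono_castAdd n) (pr p q hpq)) x _) *
          ε (∏ ij, Function.update b
          (Pair.map (Fin.castAdd n) (strictMono_castAdd n) (pr p q hpq)) x (φ ij)) *
          ev g _ (fun i => Function.update b
          (Pair.map (Fin.castAdd n) (strictMono_castAdd n) (pr p q hpq)) x _) = _
        rw [h1, hL, h2', h3]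
        simp [mul_assoc]
      | right q =>
        obtain ⟨c, hc⟩ := prod_comp_update hφi b (p, q)
        refine ⟨LinearMap.mulLeft k (ev f (fun i => a (Fin.castAdd n i))
          (fun p => b (p.map (Fin.castAdd n) (strictMono_castAdd n)))) ∘ₗ
          LinearMap.mulRight k (ε c * ev g (fun i => a (Fin.natAdd m i))
          (fun p => b (p.map (Fin.natAdd m) (Fin.strictMono_natAdd m)))) ∘ₗ ε.toLinearMap,
          fun x => ?_⟩
        have h2 := comp_update_of_notMem
          (φ := Pair.map (Fin.castAdd n) (strictMono_castAdd n)) b (r := φ (p, q))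
          (fun i hi => (castAdd_lt_natAdd i.1.2 q).ne
            (congrArg (fun r : Pair (m + n) => r.1.2) hi)) x
        have h3 := comp_update_of_notMem
          (φ := Pair.map (Fin.natAdd m) (Fin.strictMono_natAdd m)) b (r := φ (p, q))
          (fun i hi => (castAdd_lt_natAdd p i.1.1).ne'
            (congrArg (fun r : Pair (m + n) => r.1.1) hi)) x
        change ev f _ (fun i => Function.update b (φ (p, q)) x _) *
          ε (∏ ij, Function.update b (φ (p, q)) x (φ ij)) *
          ev g _ (fun i => Function.update b (φ (p, q)) x _) = _
        rw [h2, hc, h3]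
        simp [mul_assoc]
    | right p =>
      induction q using Fin.addCases with
      | left q => exact absurd h (castAdd_lt_natAdd q p).not_gt
      | right q =>
        have hpq : p < q := (Fin.strictMono_natAdd m).lt_iff_lt.1 h
        obtain ⟨L, hL⟩ := (isMultilinear_ev g).right (fun i => a (Fin.natAdd m i))
          (fun p => b (p.map (Fin.natAdd m) (Fin.strictMono_natAdd m))) (pr p q hpq)
        refine ⟨LinearMap.mulLeft k (ev f (fun i => a (Fin.castAdd n i))
          (fun p => b (p.map (Fin.castAdd n) (strictMono_castAdd n))) *
          ε (∏ ij, b (φ ij))) ∘ₗ L, fun x => ?_⟩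
        have h1 := comp_update_of_injective (Pair.map_injective (Fin.strictMono_natAdd m)) b
          (pr p q hpq) x
        have h2 := comp_update_of_notMem (φ := φ) b
          (r := Pair.map (Fin.natAdd m) (Fin.strictMono_natAdd m) (pr p q hpq))
          (fun i hi => (castAdd_lt_natAdd i.1 p).ne
            (congrArg (fun r : Pair (m + n) => r.1.1) hi)) x
        have h2' := congrArg (fun u : Fin m × Fin n → B => ∏ i, u i) h2
        have h3 := comp_update_of_notMem
          (φ := Pair.map (Fin.castAdd n) (strictMono_castAdd n)) b
          (r := Pair.map (Fin.natAdd m) (Fin.strictMono_natAdd m) (pr p q hpq))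
          (fun i hi => (castAdd_lt_natAdd i.1.1 p).ne
            (congrArg (fun r : Pair (m + n) => r.1.1) hi)) x
        change ev f _ (fun i => Function.update b
          (Pair.map (Fin.natAdd m) (Fin.strictMono_natAdd m) (pr p q hpq)) x _) *
          ε (∏ ij, Function.update b
          (Pair.map (Fin.natAdd m) (Fin.strictMono_natAdd m) (pr p q hpq)) x (φ ij)) *
          ev g _ (fun i => Function.update b
          (Pair.map (Fin.natAdd m) (Fin.strictMono_natAdd m) (pr p q hpq)) x _) = _
        rw [h1, hL, h2', h3]
        simp [mul_assoc]

theorem mergeDiag_update_left {n : ℕ} (i : Fin n) (a : Fin (n + 1) → A) (b : Pair (n + 1) → B)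
    (j : Fin (n + 1)) : ∃ (j' : Fin n) (L : A →ₗ[k] A), ∀ x,
      mergeDiag ε i (Function.update a j x) b = Function.update (mergeDiag ε i a b) j' (L x) := by
  set e := ε (b (pr i.castSucc i.succ i.castSucc_lt_succ)) with he
  by_cases h1 : j = i.castSucc
  · refine ⟨i, LinearMap.mulLeft k e ∘ₗ LinearMap.mulRight k (a i.succ), fun x => ?_⟩
    subst h1
    funext t
    simp only [mergeDiag, Function.update_apply, ← he, LinearMap.comp_apply,
      LinearMap.mulLeft_apply, LinearMap.mulRight_apply, Fin.ext_iff, Fin.lt_def,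
      Fin.val_castSucc, Fin.val_succ]
    split_ifs <;> first | omega | simp [mul_assoc]
  · by_cases h2 : j = i.succ
    · refine ⟨i, LinearMap.mulLeft k (e * a i.castSucc), fun x => ?_⟩
      subst h2
      funext t
      simp only [mergeDiag, Function.update_apply, ← he,
        LinearMap.mulLeft_apply, Fin.ext_iff, Fin.lt_def,
        Fin.val_castSucc, Fin.val_succ]
      split_ifs <;> first | omega | simp [mul_assoc]
    · refine ⟨i.predAbove j, LinearMap.id, fun x => ?_⟩
      funext t
      simp only [Fin.ext_iff, Fin.val_castSucc, Fin.val_succ] at h1 h2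
      simp only [mergeDiag, Function.update_apply, ← he, LinearMap.id_apply,
        Fin.predAbove, Fin.ext_iff, Fin.lt_def, Fin.val_castSucc, Fin.val_succ]
      split_ifs <;> simp_all <;> omega

theorem mergeUpper_update_of_ne {n : ℕ} (i : Fin n) (b : Pair (n + 1) → B) (r : Pair (n + 1))
    (hr : r ≠ pr i.castSucc i.succ i.castSucc_lt_succ) :
    ∃ (p : Pair n) (c : B), ∀ x,
      mergeUpper i (Function.update b r x) = Function.update (mergeUpper i b) p (x * c) := by
  have hlt : i.predAbove r.1.1 < i.predAbove r.1.2 := by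
    have h := r.2
    have hr' : ¬ ((r.1.1 : ℕ) = i ∧ (r.1.2 : ℕ) = i + 1) := fun hh =>
      hr (Subtype.ext (Prod.ext (Fin.ext hh.1) (Fin.ext hh.2)))
    simp only [Fin.predAbove, Fin.lt_def, Fin.val_castSucc] at h ⊢
    split_ifs <;> simp <;> omega
  refine ⟨pr _ _ hlt, ∏ s ∈ (Finset.univ.filter (fun s : Pair (n + 1) =>
    i.predAbove s.1.1 = i.predAbove r.1.1 ∧ i.predAbove s.1.2 = i.predAbove r.1.2)) \ {r}, b s,
    fun x => funext fun p => ?_⟩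
  by_cases hp : p = pr _ _ hlt
  · subst hp
    rw [Function.update_self]
    exact Finset.prod_update_of_mem (by simp) _ _
  · rw [Function.update_of_ne hp]
    refine Finset.prod_update_of_notMem (fun hmem => hp ?_) _ _
    simp only [Finset.mem_filter, Finset.mem_univ, true_and] at hmem
    exact Subtype.ext (Prod.ext hmem.1.symm hmem.2.symm)

theorem mergeUpper_update_self {n : ℕ} (i : Fin n) (b : Pair (n + 1) → B) (x : B) :
    mergeUpper i (Function.update b (pr i.castSucc i.succ i.castSucc_lt_succ) x) =
      mergeUpper i b := by
  funext p
  refine Finset.prod_update_of_notMem (fun hmem => ?_) _ _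
  simp only [Finset.mem_filter, Finset.mem_univ, true_and, Fin.predAbove_castSucc_self,
    Fin.predAbove_succ_self] at hmem
  exact absurd p.2 (by rw [← hmem.1, ← hmem.2]; exact lt_irrefl _)

theorem isMultilinear_merge {n : ℕ} (f : Cochain k A B n) (i : Fin n) :
    IsMultilinear k (fun (a : Fin (n + 1) → A) (b : Pair (n + 1) → B) =>
      ev f (mergeDiag ε i a b) (mergeUpper i b)) where
  left a b j := by
    obtain ⟨j', L, hL⟩ := mergeDiag_update_left ε i a b j
    obtain ⟨M, hM⟩ := (isMultilinear_ev f).left (mergeDiag ε i a b) (mergeUpper i b) j'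
    exact ⟨M ∘ₗ L, fun x => by rw [hL, hM]; rfl⟩
  right a b r := by
    by_cases hr : r = pr i.castSucc i.succ i.castSucc_lt_succ
    · subst hr
      obtain ⟨M, hM⟩ := (isMultilinear_ev f).left (mergeDiag ε i a b) (mergeUpper i b) i
      refine ⟨M ∘ₗ LinearMap.mulRight k (a i.castSucc * a i.succ) ∘ₗ ε.toLinearMap,
        fun x => ?_⟩
      rw [mergeUpper_update_self]
      have : mergeDiag ε i a (Function.update b (pr i.castSucc i.succ i.castSucc_lt_succ) x) =
          Function.update (mergeDiag ε i a b) i (ε x * (a i.castSucc * a i.succ)) := by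
        funext t
        by_cases ht : t = i
        · subst ht; simp [mergeDiag, mul_assoc]
        · simp [mergeDiag, ht]
      rw [this, hM]
      rfl
    · obtain ⟨p, c, hc⟩ := mergeUpper_update_of_ne i b r hr
      obtain ⟨M, hM⟩ := (isMultilinear_ev f).right (mergeDiag ε i a b) (mergeUpper i b) p
      refine ⟨M ∘ₗ LinearMap.mulRight k c, fun x => ?_⟩
      have : mergeDiag ε i a (Function.update b r x) = mergeDiag ε i a b := by
        funext t
        simp [mergeDiag, Function.update_of_ne (Ne.symm hr)]
      rw [this, hc, hM]
      rfl

theorem isMultilinear_dFun {n : ℕ} (f : Cochain k A B n) : IsMultilinear k (dFun ε f) :=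
  ((isMultilinear_firstTerm ε f).add
    (IsMultilinear.sum _ fun i => (isMultilinear_merge ε f i).smul _)).add
    ((isMultilinear_lastTerm ε f).smul _)

/-- The differential `δ^ε_n : C^n((A,B,ε);A) → C^{n+1}((A,B,ε);A)`. -/
def d (n : ℕ) : Cochain k A B n →ₗ[k] Cochain k A B (n + 1) where
  toFun f := mk (dFun ε f) (isMultilinear_dFun ε f)
  map_add' f g := ev_ext fun a b => by
    simp only [ev_mk, ev_add, dFun, firstTerm, lastTerm, mul_add, add_mul, smul_add,
      Finset.sum_add_distrib]
    abel
  map_smul' c f := ev_ext fun a b => by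
    simp only [ev_mk, ev_smul, dFun, firstTerm, lastTerm, smul_add, Finset.smul_sum,
      RingHom.id_apply, mul_smul_comm, smul_mul_assoc, smul_comm c]

/-- The cup product of cochains. -/
def cupC (m n : ℕ) :
    Cochain k A B m →ₗ[k] Cochain k A B n →ₗ[k] Cochain k A B (m + n) :=
  LinearMap.mk₂ k (fun f g => mk (cupFun ε f g) (isMultilinear_cupFun ε f g))
    (fun f f' g => ev_ext fun a b => by simp [cupFun, add_mul])
    (fun c f g => ev_ext fun a b => by simp [cupFun])
    (fun f g g' => ev_ext fun a b => by simp [cupFun, mul_add])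
    (fun c f g => ev_ext fun a b => by simp [cupFun])

/-- The cocycles. -/
def cocycles (n : ℕ) : Submodule k (Cochain k A B n) := LinearMap.ker (d ε n)

/-- The coboundaries (`0` in degree `0`). -/
def coboundaries : (n : ℕ) → Submodule k (Cochain k A B n)
  | 0 => ⊥
  | n + 1 => LinearMap.range (d ε n)

/-- The secondary Hochschild cohomology `H^n((A,B,ε);A)`: cocycles modulo coboundaries. -/
def Cohomology (n : ℕ) : Type _ :=
  cocycles ε n ⧸ (coboundaries ε n).submoduleOf (cocycles ε n)

instance (n : ℕ) : AddCommGroup (Cohomology ε n) :=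
  inferInstanceAs (AddCommGroup (cocycles ε n ⧸ (coboundaries ε n).submoduleOf (cocycles ε n)))

instance (n : ℕ) : Module k (Cohomology ε n) :=
  inferInstanceAs (Module k (cocycles ε n ⧸ (coboundaries ε n).submoduleOf (cocycles ε n)))

/-- The class of a cocycle. -/
def cls (n : ℕ) : cocycles ε n →ₗ[k] Cohomology ε n :=
  ((coboundaries ε n).submoduleOf (cocycles ε n)).mkQ

/-! The Leibniz rule. To avoid casts between `Fin (m + 1 + n)` and `Fin (m + n + 1)`, cochains are
evaluated on matrices with rows and columns indexed by `ℕ`, of which only a corner is used. -/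

/-- Evaluation on the upper left corner of a matrix indexed by `ℕ`. -/
def evN {n : ℕ} (f : Cochain k A B n) (a : ℕ → A) (b : ℕ → ℕ → B) : A :=
  ev f (fun i => a i) (fun p => b p.1.1 p.1.2)

theorem evN_ext {n : ℕ} {f g : Cochain k A B n} (h : ∀ a b, evN f a b = evN g a b) : f = g := by
  refine ev_ext fun a b => ?_
  have := h (fun i => if h : i < n then a ⟨i, h⟩ else 0)
    (fun i j => if h : i < j ∧ j < n then b (pr ⟨i, h.1.trans h.2⟩ ⟨j, h.2⟩ h.1) else 0)
  simp only [evN, Fin.is_lt, dite_true, Fin.eta] at this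
  convert this using 2
  all_goals
    funext p
    have h1 : (p.1.1 : ℕ) < p.1.2 := p.2
    simp [h1]

theorem evN_congr {n : ℕ} (f : Cochain k A B n) {a a' : ℕ → A} {b b' : ℕ → ℕ → B}
    (ha : ∀ i < n, a i = a' i) (hb : ∀ i j, i < j → j < n → b i j = b' i j) :
    evN f a b = evN f a' b' := by
  unfold evN
  congr 1
  · funext i; exact ha i i.2
  · funext p; exact hb _ _ p.2 p.1.2.2

/-- Merging of neighbouring entries `i` and `i + 1` of a sequence under a binary operation. -/
def mergeN {R : Type*} (op : R → R → R) (i : ℕ) (u : ℕ → R) (j : ℕ) : R :=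
  if j < i then u j else if j = i then op (u i) (u (i + 1)) else u (j + 1)

/-- Merging of neighbouring rows and columns above the diagonal. -/
def mergeN₂ (i : ℕ) (b : ℕ → ℕ → B) (p q : ℕ) : B :=
  mergeN (· * ·) i (fun p' => mergeN (· * ·) i (b p') q) p

theorem mergeUpper_nat {n : ℕ} (i : Fin n) (b : ℕ → ℕ → B) (p : Pair n) :
    mergeUpper i (fun r => b r.1.1 r.1.2) p = mergeN₂ i b p.1.1 p.1.2 := by
  obtain ⟨⟨p, q⟩, h⟩ := p
  have hpq : (p : ℕ) < q := h
  have hval : ∀ r : Fin (n + 1), ∀ t : Fin n, i.predAbove r = t ↔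
      ((r : ℕ) ≤ i ∧ (r : ℕ) = t) ∨ ((i : ℕ) < r ∧ (r : ℕ) = t + 1) := by
    intro r t
    simp only [Fin.predAbove, Fin.lt_def, Fin.ext_iff, Fin.val_castSucc]
    split_ifs <;> simp <;> omega
  have one : ∀ (P Q : Fin (n + 1)) (hPQ : P < Q),
      (∀ r : Pair (n + 1), (i.predAbove r.1.1 = p ∧ i.predAbove r.1.2 = q) ↔
        ((r.1.1 : ℕ) = P ∧ (r.1.2 : ℕ) = Q)) →
      mergeUpper i (fun r => b r.1.1 r.1.2) ⟨(p, q), h⟩ = b P Q := by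
    intro P Q hPQ hr
    unfold mergeUpper
    rw [Finset.prod_eq_single (pr P Q hPQ)]
    · intro r hmem hne
      refine absurd (Subtype.ext (Prod.ext (Fin.ext ?_) (Fin.ext ?_))) hne
      · exact ((hr r).1 (by simpa using hmem)).1
      · exact ((hr r).1 (by simpa using hmem)).2
    · intro hmem
      exact absurd ((hr (pr P Q hPQ)).2 ⟨rfl, rfl⟩) (by simpa using hmem)
  have two : ∀ (P Q P' Q' : Fin (n + 1)) (hPQ : P < Q) (hPQ' : P' < Q')
      (_ : pr P Q hPQ ≠ pr P' Q' hPQ'),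
      (∀ r : Pair (n + 1), (i.predAbove r.1.1 = p ∧ i.predAbove r.1.2 = q) ↔
        (((r.1.1 : ℕ) = P ∧ (r.1.2 : ℕ) = Q) ∨ ((r.1.1 : ℕ) = P' ∧ (r.1.2 : ℕ) = Q'))) →
      mergeUpper i (fun r => b r.1.1 r.1.2) ⟨(p, q), h⟩ = b P Q * b P' Q' := by
    intro P Q P' Q' hPQ hPQ' hne hr
    unfold mergeUpper
    have : (Finset.univ.filter fun r : Pair (n + 1) =>
        i.predAbove r.1.1 = p ∧ i.predAbove r.1.2 = q) = {pr P Q hPQ, pr P' Q' hPQ'} := by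
      ext r
      simp only [Finset.mem_filter, Finset.mem_univ, true_and, Finset.mem_insert,
        Finset.mem_singleton, hr]
      simp only [Subtype.ext_iff, Prod.ext_iff, Fin.ext_iff]
    rw [this, Finset.prod_pair hne]
  simp only [hval] at one two
  simp only [mergeN₂, mergeN]
  rcases lt_trichotomy (q : ℕ) i with hq | hq | hq
  · rw [one p.castSucc q.castSucc h (by intro r; simp; omega)]
    simp [hq, hpq.trans hq]
  · rw [two p.castSucc q.castSucc p.castSucc q.succ h (by rw [Fin.lt_def]; simp; omega)
      (by simp [Fin.ext_iff]) (by intro r; simp; omega)]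
    simp [hq, show (p : ℕ) < i by omega]
  · have hq1 : ¬ (q : ℕ) < i := by omega
    have hq2 : ¬ (q : ℕ) = i := by omega
    rcases lt_trichotomy (p : ℕ) i with hp | hp | hp
    · rw [one p.castSucc q.succ (by rw [Fin.lt_def]; simp; omega) (by intro r; simp; omega)]
      simp [hq1, hq2, hp]
    · rw [two p.castSucc q.succ p.succ q.succ (by rw [Fin.lt_def]; simp; omega)
        (by rw [Fin.lt_def]; simp; omega) (by simp [Fin.ext_iff]) (by intro r; simp; omega)]
      simp [hq1, hq2, hp]
    · rw [one p.succ q.succ (by rw [Fin.lt_def]; simp; omega) (by intro r; simp; omega)]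
      simp [hq1, hq2, show ¬ (p : ℕ) < i by omega, show ¬ (p : ℕ) = i by omega]

theorem evN_d {n : ℕ} (f : Cochain k A B n) (a : ℕ → A) (b : ℕ → ℕ → B) :
    evN (d ε n f) a b =
      a 0 * ε (∏ j ∈ Finset.range n, b 0 (j + 1)) *
        evN f (fun i => a (i + 1)) (fun i j => b (i + 1) (j + 1))
      + ∑ i ∈ Finset.range n, (-1 : k) ^ (i + 1) •
          evN f (mergeN (fun x y => ε (b i (i + 1)) * x * y) i a) (mergeN₂ i b)
      + (-1 : k) ^ (n + 1) • (evN f a b * a n * ε (∏ i ∈ Finset.range n, b i n)) := by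
  simp only [Finset.prod_range, Finset.sum_range]
  have : ∀ i : Fin n, mergeDiag ε i (fun j => a j) (fun r => b r.1.1 r.1.2) =
      fun j : Fin n => mergeN (fun x y => ε (b i (i + 1)) * x * y) i a j := by
    intro i
    funext j
    simp only [mergeDiag, mergeN, Fin.lt_def, Fin.ext_iff, Fin.val_castSucc, Fin.val_succ]
  simp only [evN, d, LinearMap.coe_mk, AddHom.coe_mk, ev_mk, dFun, this]
  have h2 : ∀ i : Fin n, mergeUpper i (fun r => b r.1.1 r.1.2) =
      fun p => mergeN₂ i b p.1.1 p.1.2 := fun i => funext fun p => mergeUpper_nat i b p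
  simp only [h2]
  rfl

theorem evN_cup {m n : ℕ} (f : Cochain k A B m) (g : Cochain k A B n) (a : ℕ → A)
    (b : ℕ → ℕ → B) :
    evN (cupC ε m n f g) a b =
      evN f a b * ε (∏ i ∈ Finset.range m, ∏ j ∈ Finset.range n, b i (m + j)) *
        evN g (fun i => a (m + i)) (fun i j => b (m + i) (m + j)) := by
  simp only [Finset.prod_range]
  rw [← Fintype.prod_prod_type' (f := fun (i : Fin m) (j : Fin n) => b i (m + j))]
  simp only [cupC, LinearMap.mk₂_apply, evN, ev_mk]
  rfl

theorem prod_mergeN_of_lt {i m : ℕ} (u : ℕ → B) (h : i < m) :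
    ∏ p ∈ Finset.range m, mergeN (· * ·) i u p = ∏ p ∈ Finset.range (m + 1), u p := by
  obtain ⟨l, rfl⟩ : ∃ l, m = i + 1 + l := ⟨m - (i + 1), by omega⟩
  rw [Finset.prod_range_add, show i + 1 + l + 1 = i + 1 + 1 + l by omega,
    Finset.prod_range_add u,
    Finset.prod_range_succ, Finset.prod_range_succ u (i + 1), Finset.prod_range_succ u i]
  congr 1
  · rw [mul_assoc]
    congr 1
    · exact Finset.prod_congr rfl fun p hp => by simp [mergeN, Finset.mem_range.1 hp]
    · simp [mergeN]
  · refine Finset.prod_congr rfl fun p _ => ?_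
    simp only [mergeN]
    rw [if_neg (by omega), if_neg (by omega)]
    congr 1
    omega

theorem mergeN_of_lt {R : Type*} (op : R → R → R) {i j : ℕ} (u : ℕ → R) (h : j < i) :
    mergeN op i u j = u j := if_pos h

theorem mergeN_of_gt {R : Type*} (op : R → R → R) {i j : ℕ} (u : ℕ → R) (h : i < j) :
    mergeN op i u j = u (j + 1) := by
  rw [mergeN, if_neg (by omega), if_neg (by omega)]

theorem mergeN_add {R : Type*} (op : R → R → R) (m i j : ℕ) (u : ℕ → R) :
    mergeN op (m + i) u (m + j) = mergeN op i (fun t => u (m + t)) j := by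
  simp [mergeN, add_assoc]

theorem leibniz (hε : ∀ x, ε x ∈ Subalgebra.center k A) {m n : ℕ} (f : Cochain k A B m)
    (g : Cochain k A B n) (a : ℕ → A) (b : ℕ → ℕ → B) :
    evN (d ε (m + n) (cupC ε m n f g)) a b =
      evN (cupC ε (m + 1) n (d ε m f) g) a b +
        (-1 : k) ^ m • evN (cupC ε m (n + 1) f (d ε n g)) a b := by
  have comm : ∀ (x : B) (y : A), y * ε x = ε x * y := fun x y =>
    Subalgebra.mem_center_iff.1 (hε x) y
  have L1 : ∀ (x y : B) (p q r : A), p * ε x * (q * ε y * r) = ε (x * y) * (p * q * r) := by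
    intro x y p q r
    rw [comm x p, comm y q, map_mul, mul_assoc, mul_assoc, mul_assoc, ← mul_assoc p, comm y p]
    simp only [mul_assoc]
  have L2 : ∀ (x y : B) (p q r : A), p * ε x * q * ε y * r = ε (x * y) * (p * q * r) := by
    intro x y p q r
    rw [← L1]
    simp only [mul_assoc]
  set P := ∏ i ∈ Finset.range (m + 1), ∏ j ∈ Finset.range n, b i (m + 1 + j) with hP
  set Q := ∏ i ∈ Finset.range m, ∏ j ∈ Finset.range (n + 1), b i (m + j) with hQ
  set G := evN g (fun i => a (m + 1 + i)) (fun i j => b (m + 1 + i) (m + 1 + j)) with hG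
  have hG' : evN g (fun i => a (m + (i + 1))) (fun i j => b (m + (i + 1)) (m + (j + 1))) = G := by
    simp only [hG, add_assoc, add_comm 1]
  have hG'' : evN g (fun i => a (m + i + 1)) (fun i j => b (m + i + 1) (m + j + 1)) = G := hG'
  -- the first term
  have T1 : a 0 * ε (∏ j ∈ Finset.range (m + n), b 0 (j + 1)) *
      evN (cupC ε m n f g) (fun i => a (i + 1)) (fun i j => b (i + 1) (j + 1)) =
      a 0 * ε (∏ j ∈ Finset.range m, b 0 (j + 1)) *
        evN f (fun i => a (i + 1)) (fun i j => b (i + 1) (j + 1)) * ε P * G := by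
    rw [evN_cup, hG'']
    have : (∏ j ∈ Finset.range (m + n), b 0 (j + 1)) *
        (∏ i ∈ Finset.range m, ∏ j ∈ Finset.range n, b (i + 1) (m + j + 1)) =
        (∏ j ∈ Finset.range m, b 0 (j + 1)) * P := by
      rw [hP, Finset.prod_range_succ', Finset.prod_range_add]
      simp only [show ∀ j, m + 1 + j = m + j + 1 from fun j => by omega]
      ring
    rw [L1, L2, this]
  -- merging inside the first block
  have T2 : ∀ i ∈ Finset.range m,
      evN (cupC ε m n f g) (mergeN (fun x y => ε (b i (i + 1)) * x * y) i a) (mergeN₂ i b) =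
      evN f (mergeN (fun x y => ε (b i (i + 1)) * x * y) i a) (mergeN₂ i b) * ε P * G := by
    intro i hi
    have hi := Finset.mem_range.1 hi
    rw [evN_cup]
    rw [← hG'']
    congr 1
    · congr 2
      rw [hP, Finset.prod_comm, Finset.prod_comm (s := Finset.range (m + 1))]
      refine Finset.prod_congr rfl fun q _ => ?_
      simp only [mergeN₂]
      rw [prod_mergeN_of_lt _ hi]
      refine Finset.prod_congr rfl fun p _ => ?_
      rw [mergeN_of_gt _ _ (by omega), add_right_comm]
    · refine evN_congr g (fun t _ => mergeN_of_gt _ _ (by omega)) fun p q _ _ => ?_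
      simp only [mergeN₂]
      rw [mergeN_of_gt _ _ (by omega), mergeN_of_gt _ _ (by omega)]
  -- merging inside the second block
  have T3 : ∀ i ∈ Finset.range n,
      evN (cupC ε m n f g) (mergeN (fun x y => ε (b (m + i) (m + i + 1)) * x * y) (m + i) a)
        (mergeN₂ (m + i) b) =
      evN f a b * ε Q * evN g (mergeN (fun x y => ε (b (m + i) (m + (i + 1))) * x * y) i
        (fun t => a (m + t))) (mergeN₂ i (fun p q => b (m + p) (m + q))) := by
    intro i hi
    have hi := Finset.mem_range.1 hi
    rw [evN_cup]
    congr 2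
    · refine evN_congr f (fun t _ => mergeN_of_lt _ _ (by omega)) fun p q _ _ => ?_
      simp only [mergeN₂]
      rw [mergeN_of_lt _ _ (by omega), mergeN_of_lt _ _ (by omega)]
    · congr 1
      refine Finset.prod_congr rfl fun p hp => ?_
      have hp := Finset.mem_range.1 hp
      rw [← prod_mergeN_of_lt (fun j => b p (m + j)) hi]
      refine Finset.prod_congr rfl fun q _ => ?_
      simp only [mergeN₂]
      rw [mergeN_of_lt _ _ (by omega), mergeN_add]
    · funext t
      rw [mergeN_add]
      rfl
    · funext p q
      simp only [mergeN₂, mergeN_add]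
  -- the last term
  have T4 : evN (cupC ε m n f g) a b * a (m + n) * ε (∏ i ∈ Finset.range (m + n), b i (m + n)) =
      evN f a b * ε Q * (evN g (fun i => a (m + i)) (fun i j => b (m + i) (m + j)) * a (m + n) *
        ε (∏ i ∈ Finset.range n, b (m + i) (m + n))) := by
    rw [evN_cup]
    have : (∏ i ∈ Finset.range (m + n), b i (m + n)) *
        (∏ i ∈ Finset.range m, ∏ j ∈ Finset.range n, b i (m + j)) =
        (∏ i ∈ Finset.range n, b (m + i) (m + n)) * Q := by
      simp only [hQ, Finset.prod_range_succ, Finset.prod_mul_distrib, Finset.prod_range_add]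
      ring
    have h1 := L2 (∏ i ∈ Finset.range m, ∏ j ∈ Finset.range n, b i (m + j))
      (∏ i ∈ Finset.range (m + n), b i (m + n)) (evN f a b)
      (evN g (fun i => a (m + i)) (fun i j => b (m + i) (m + j)) * a (m + n)) 1
    have h2 := L1 Q (∏ i ∈ Finset.range n, b (m + i) (m + n)) (evN f a b)
      (evN g (fun i => a (m + i)) (fun i j => b (m + i) (m + j)) * a (m + n)) 1
    rw [mul_comm, this, mul_comm, ← h2] at h1
    simpa only [mul_assoc, mul_one] using h1
  -- the two terms that cancel
  have T5 : evN f a b * a m * ε (∏ i ∈ Finset.range m, b i m) * ε P * G =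
      evN f a b * ε Q * (a m * ε (∏ j ∈ Finset.range n, b m (m + (j + 1))) * G) := by
    have : (∏ i ∈ Finset.range m, b i m) * P =
        (∏ j ∈ Finset.range n, b m (m + (j + 1))) * Q := by
      simp only [hP, hQ, Finset.prod_range_succ', Finset.prod_range_succ _ m,
        Finset.prod_mul_distrib, add_zero]
      simp only [show ∀ j, m + 1 + j = m + (j + 1) from fun j => by omega]
      ring
    have h1 := L2 (∏ i ∈ Finset.range m, b i m) P (evN f a b * a m) 1 G
    rw [mul_one, mul_one] at h1
    rw [h1, L1, this, mul_comm Q]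
  rw [evN_d, evN_cup ε (d ε m f), evN_cup ε f (d ε n g), evN_d, evN_d, T1, T4,
    Finset.sum_range_add, Finset.sum_congr rfl fun i hi => congrArg _ (T2 i hi),
    Finset.sum_congr rfl fun i hi => congrArg (fun z => (-1 : k) ^ (m + i + 1) • z) (T3 i hi)]
  rw [hG']
  simp only [add_mul, mul_add, smul_add, Finset.sum_mul, Finset.mul_sum, Finset.smul_sum,
    smul_mul_assoc, mul_smul_comm, smul_smul, ← pow_add, add_zero]
  rw [← hP, ← hQ, ← hG, T5]
  rw [show (-1 : k) ^ (m + 1) = - (-1 : k) ^ m by ring, neg_smul]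
  simp only [← add_assoc]
  abel

theorem evN_zero {n : ℕ} (a b) : evN (0 : Cochain k A B n) a b = 0 := rfl

theorem evN_add {n : ℕ} (f g : Cochain k A B n) (a b) :
    evN (f + g) a b = evN f a b + evN g a b := rfl

theorem evN_smul {n : ℕ} (c : k) (f : Cochain k A B n) (a b) :
    evN (c • f) a b = c • evN f a b := rfl

theorem mem_coboundaries_of_evN {N M : ℕ} (h : M + 1 = N) (y : Cochain k A B M)
    (x : Cochain k A B N) (hxy : ∀ a b, evN (d ε M y) a b = evN x a b) :
    x ∈ coboundaries ε N := by
  subst h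
  exact ⟨y, evN_ext hxy⟩

theorem cupC_mem_cocycles (hε : ∀ x, ε x ∈ Subalgebra.center k A) {m n : ℕ}
    {f : Cochain k A B m} {g : Cochain k A B n} (hf : f ∈ cocycles ε m)
    (hg : g ∈ cocycles ε n) : cupC ε m n f g ∈ cocycles ε (m + n) := by
  refine LinearMap.mem_ker.2 (evN_ext fun a b => ?_)
  rw [leibniz ε hε, LinearMap.mem_ker.1 hf, LinearMap.mem_ker.1 hg]
  simp [evN_zero]

theorem cupC_mem_coboundaries_left (hε : ∀ x, ε x ∈ Subalgebra.center k A) {m n : ℕ}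
    {f : Cochain k A B m} {g : Cochain k A B n} (hf : f ∈ coboundaries ε m)
    (hg : g ∈ cocycles ε n) : cupC ε m n f g ∈ coboundaries ε (m + n) := by
  cases m with
  | zero =>
    obtain rfl : f = 0 := hf
    simp
  | succ m =>
    obtain ⟨h, rfl⟩ := hf
    refine mem_coboundaries_of_evN ε (by omega) (cupC ε m n h g) _ fun a b => ?_
    rw [leibniz ε hε, LinearMap.mem_ker.1 hg]
    simp [evN_zero]

theorem cupC_mem_coboundaries_right (hε : ∀ x, ε x ∈ Subalgebra.center k A) {m n : ℕ}
    {f : Cochain k A B m} {g : Cochain k A B n} (hf : f ∈ cocycles ε m)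
    (hg : g ∈ coboundaries ε n) : cupC ε m n f g ∈ coboundaries ε (m + n) := by
  cases n with
  | zero =>
    obtain rfl : g = 0 := hg
    simp
  | succ n =>
    obtain ⟨h, rfl⟩ := hg
    refine mem_coboundaries_of_evN ε (by omega) ((-1 : k) ^ m • cupC ε m n f h) _ fun a b => ?_
    rw [map_smul, evN_smul, leibniz ε hε, LinearMap.mem_ker.1 hf]
    simp [evN_zero, smul_smul, ← mul_pow]

/-- The cup product of cocycles. -/
def cupZ (hε : ∀ x, ε x ∈ Subalgebra.center k A) (m n : ℕ) :
    cocycles ε m →ₗ[k] cocycles ε n →ₗ[k] cocycles ε (m + n) :=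
  LinearMap.mk₂ k (fun f g => ⟨cupC ε m n f g, cupC_mem_cocycles ε hε f.2 g.2⟩)
    (fun _ _ _ => Subtype.ext (by simp)) (fun _ _ _ => Subtype.ext (by simp))
    (fun _ _ _ => Subtype.ext (by simp)) (fun _ _ _ => Subtype.ext (by simp))

/-- The cup product `H^m((A,B,ε);A) × H^n((A,B,ε);A) → H^{m+n}((A,B,ε);A)`,
`[f] ⌣ [g] = [f ⌣ g]`. -/
def cupH (hε : ∀ x, ε x ∈ Subalgebra.center k A) (m n : ℕ) :
    Cohomology ε m →ₗ[k] Cohomology ε n →ₗ[k] Cohomology ε (m + n) :=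
  Submodule.liftQ _
    { toFun := fun f => Submodule.liftQ _ (cls ε (m + n) ∘ₗ cupZ ε hε m n f) (fun g hg =>
        LinearMap.mem_ker.2 ((Submodule.Quotient.mk_eq_zero _).2
          (cupC_mem_coboundaries_right ε hε f.2 hg)))
      map_add' := fun f f' => Submodule.linearMap_qext _ (by ext g; simp; rfl)
      map_smul' := fun c f => Submodule.linearMap_qext _ (by ext g; simp; rfl) }
    (fun f hf => LinearMap.mem_ker.2 (Submodule.linearMap_qext _ (LinearMap.ext fun g =>
      (Submodule.Quotient.mk_eq_zero _).2 (cupC_mem_coboundaries_left ε hε hf g.2))))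

theorem cupH_cls (hε : ∀ x, ε x ∈ Subalgebra.center k A) (m n : ℕ) (f : cocycles ε m)
    (g : cocycles ε n) :
    cupH ε hε m n (cls ε m f) (cls ε n g) =
      cls ε (m + n) ⟨cupC ε m n f g, cupC_mem_cocycles ε hε f.2 g.2⟩ := rfl

/-- The total cohomology `H^*((A,B,ε);A)`. -/
abbrev TotalCohomology : Type _ := ⨁ n, Cohomology ε n

/-- The cup product on `H^*((A,B,ε);A)`, the bilinear extension of the cup products of
homogeneous classes. -/
def cup (hε : ∀ x, ε x ∈ Subalgebra.center k A) :
    TotalCohomology ε →ₗ[k] TotalCohomology ε →ₗ[k] TotalCohomology ε :=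
  DirectSum.toModule k ℕ _ fun m => LinearMap.flip <| DirectSum.toModule k ℕ _ fun n =>
    LinearMap.flip <| (cupH ε hε m n).compr₂ (DirectSum.lof k ℕ (Cohomology ε) (m + n))

theorem cup_lof (hε : ∀ x, ε x ∈ Subalgebra.center k A) (m n : ℕ) (x : Cohomology ε m)
    (y : Cohomology ε n) :
    cup ε hε (DirectSum.lof k ℕ (Cohomology ε) m x) (DirectSum.lof k ℕ (Cohomology ε) n y) =
      DirectSum.lof k ℕ (Cohomology ε) (m + n) (cupH ε hε m n x y) := by
  simp [cup]

end Complex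

end SecondaryHochschild

end

/-!
Replacing a diagonal entry of a matrix by a block turns the secondary Hochschild cochains into an
operad: `F ∘ᵢ G` applies `G` to the diagonal block that starts at the index `i`, writes the value on
the diagonal, multiplies the entries of each off-diagonal block, and applies `F`. The `2`-cochain
`μ(T) = ε(b₁₂) a₁ a₂` is a multiplication of this operad. Moving the central scalars to the front,
all the summands of the differential and the cup product are partial compositions with `μ`, and
Gerstenhaber's argument applies: for `F` of arity `m` and `G` of arity `n`, the composition
`F ∘ G = ∑ᵢ (-1)^(i(n+1)) F ∘ᵢ G` satisfies
`δ(F ∘ G) = F ∘ δG - (-1)^n δF ∘ G - (-1)^n ((-1)^(mn) F ⌣ G - G ⌣ F)`,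
so it is a homotopy between the two cup products when `F` and `G` are cocycles.
-/

noncomputable section

namespace SecondaryHochschild

section Blocks

/-- The cut points of the partition of `ℕ` into the block `{i, …, i + n - 1}` and singletons: the
`p`-th part is the interval from `cut i n p` to `cut i n (p + 1)`. For `n = 0` the `i`-th part is
empty. -/
def cut (i n p : ℕ) : ℕ := if p ≤ i then p else p + n - 1

/-- The sequence `a` with the block `{i, …, i + n - 1}` collapsed to the single entry `z`. -/
def collapse {R : Type*} (i n : ℕ) (z : R) (a : ℕ → R) (j : ℕ) : R :=
  if j < i then a j else if j = i then z else a (j + n - 1)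

theorem monotone_cut (i n : ℕ) : Monotone (cut i n) := by
  intro p q h
  unfold cut
  split_ifs <;> omega

theorem cut_of_le {i n p : ℕ} (h : p ≤ i) : cut i n p = p := if_pos h

theorem cut_of_lt {i n p : ℕ} (h : i < p) : cut i n p = p + n - 1 := if_neg (by omega)

theorem exists_cut_le_lt_cut (i n r : ℕ) : ∃ p, cut i n p ≤ r ∧ r < cut i n (p + 1) := by
  refine ⟨if r < i then r else if r < i + n then i else r + 1 - n, ?_⟩
  unfold cut
  split_ifs <;> omega

theorem cut_comp_cut_of_lt {t l : ℕ} (h : t < l) (i s : ℕ) :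
    cut (i + t) s ∘ cut i l = cut i (l + s - 1) := by
  funext p
  simp only [Function.comp_apply, cut]
  split_ifs <;> omega

theorem cut_comp_cut_comm {i j : ℕ} (h : i < j) (m n : ℕ) :
    cut i m ∘ cut j n = cut (j + m - 1) n ∘ cut i m := by
  funext p
  simp only [Function.comp_apply, cut]
  split_ifs <;> omega

variable {R : Type*}

theorem collapse_of_lt {i n j : ℕ} (h : j < i) (z : R) (a : ℕ → R) :
    collapse i n z a j = a j := if_pos h

theorem collapse_self (i n : ℕ) (z : R) (a : ℕ → R) : collapse i n z a i = z := by
  simp [collapse]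

theorem collapse_of_gt {i n j : ℕ} (h : i < j) (z : R) (a : ℕ → R) :
    collapse i n z a j = a (j + n - 1) := by
  rw [collapse, if_neg (by omega), if_neg (by omega)]

theorem collapse_shift (i t s : ℕ) (z : R) (a : ℕ → R) :
    (fun x => collapse (i + t) s z a (i + x)) = collapse t s z fun x => a (i + x) := by
  funext x
  grind [collapse]

theorem collapse_collapse_of_lt {t l : ℕ} (h : t < l) (i s : ℕ) (y z : R) (a : ℕ → R) :
    collapse i l y (collapse (i + t) s z a) = collapse i (l + s - 1) y a := by
  funext j
  grind [collapse]

theorem collapse_collapse_comm {i j : ℕ} (h : i < j) (m n : ℕ) (y z : R) (a : ℕ → R) :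
    collapse j n y (collapse i m z a) = collapse i m z (collapse (j + m - 1) n y a) := by
  funext p
  grind [collapse]

theorem collapse_eq_update (i n : ℕ) (y z : R) (a : ℕ → R) :
    collapse i n z a = Function.update (collapse i n y a) i z := by
  funext j
  grind [collapse, Function.update_apply]

theorem collapse_update_of_mem {i n r : ℕ} (hi : i ≤ r) (hr : r < i + n) (z x : R) (a : ℕ → R) :
    collapse i n z (Function.update a r x) = collapse i n z a := by
  funext j
  grind [collapse, Function.update_apply]

theorem exists_collapse_update {i m n r : ℕ} (hi : i < m) (hr : r < m + n - 1)
    (h : r < i ∨ i + n ≤ r) (z : R) (a : ℕ → R) :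
    ∃ j < m, ∀ x, collapse i n z (Function.update a r x) =
      Function.update (collapse i n z a) j x := by
  refine ⟨if r < i then r else r + 1 - n, by grind, fun x => funext fun j => ?_⟩
  grind [collapse, Function.update_apply]

/-- The matrix `b` with the entry at `(r, s)` replaced by `x`. -/
def updateEntry (b : ℕ → ℕ → R) (r s : ℕ) (x : R) : ℕ → ℕ → R :=
  Function.update b r (Function.update (b r) s x)

theorem updateEntry_apply (b : ℕ → ℕ → R) (r s : ℕ) (x : R) (p q : ℕ) :
    updateEntry b r s x p q = if p = r ∧ q = s then x else b p q := by
  rcases eq_or_ne p r with rfl | hp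
  · simp [updateEntry, Function.update_apply]
  · simp [updateEntry, hp]

variable {M : Type*} [CommMonoid M]

/-- The products of a sequence over the intervals with cut points `c`. -/
def blockProd (c : ℕ → ℕ) (u : ℕ → M) (p : ℕ) : M := ∏ r ∈ Finset.Ico (c p) (c (p + 1)), u r

/-- The products of the entries of a matrix over the rectangles with cut points `c`. -/
def blockProd₂ (c : ℕ → ℕ) (b : ℕ → ℕ → M) (p q : ℕ) : M :=
  blockProd c (fun r => blockProd c (b r) q) p

theorem prod_Ico_blockProd {c : ℕ → ℕ} (hc : Monotone c) (u : ℕ → M) {s t : ℕ} (h : s ≤ t) :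
    ∏ p ∈ Finset.Ico s t, blockProd c u p = ∏ r ∈ Finset.Ico (c s) (c t), u r := by
  induction t, h using Nat.le_induction with
  | base => simp
  | succ t h ih =>
    rw [Finset.prod_Ico_succ_top h, ih, blockProd,
      Finset.prod_Ico_consecutive _ (hc h) (hc t.le_succ)]

theorem blockProd_blockProd {c c' : ℕ → ℕ} (hc : Monotone c) (hc' : Monotone c') (u : ℕ → M) :
    blockProd c' (blockProd c u) = blockProd (c ∘ c') u :=
  funext fun p => prod_Ico_blockProd hc u (hc' p.le_succ)

theorem blockProd₂_blockProd₂ {c c' : ℕ → ℕ} (hc : Monotone c) (hc' : Monotone c')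
    (b : ℕ → ℕ → M) : blockProd₂ c' (blockProd₂ c b) = blockProd₂ (c ∘ c') b := by
  have swap (q p : ℕ) : blockProd c' (fun s => blockProd c (fun r => blockProd c (b r) s) p) q =
      blockProd c (fun r => blockProd c' (blockProd c (b r)) q) p := Finset.prod_comm
  funext p q
  simp only [blockProd₂, ← blockProd_blockProd hc hc']
  exact congrArg (blockProd c' · p) (funext (swap q))

theorem blockProd₂_shift (c : ℕ → ℕ) (s : ℕ) (b : ℕ → ℕ → M) :
    blockProd₂ c (fun p q => b (s + p) (s + q)) = blockProd₂ (fun p => s + c p) b := by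
  funext p q
  simp only [blockProd₂, blockProd, ← Finset.prod_Ico_add, add_comm s]

theorem blockProd_of_succ {c : ℕ → ℕ} {p : ℕ} (hp : c (p + 1) = c p + 1) (u : ℕ → M) :
    blockProd c u p = u (c p) := by
  simp [blockProd, hp]

theorem blockProd₂_of_succ {c : ℕ → ℕ} {p q : ℕ} (hp : c (p + 1) = c p + 1)
    (hq : c (q + 1) = c q + 1) (b : ℕ → ℕ → M) : blockProd₂ c b p q = b (c p) (c q) := by
  rw [blockProd₂, blockProd_of_succ hp, blockProd_of_succ hq]

theorem blockProd_cut_self (i n : ℕ) (u : ℕ → M) :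
    blockProd (cut i n) u i = ∏ j ∈ Finset.range n, u (i + j) := by
  rw [blockProd, cut_of_le le_rfl, cut_of_lt i.lt_succ_self, Finset.prod_Ico_eq_prod_range]
  congr 2
  omega

theorem blockProd₂_cut_zero_succ (m j : ℕ) (b : ℕ → ℕ → M) :
    blockProd₂ (cut 0 m) b 0 (j + 1) = ∏ i ∈ Finset.range m, b i (m + j) := by
  rw [blockProd₂, blockProd_cut_self]
  refine Finset.prod_congr rfl fun i _ => ?_
  rw [blockProd_of_succ (by grind [cut]), zero_add, cut_of_lt j.succ_pos]
  congr 1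
  omega

theorem blockProd₂_congr {c : ℕ → ℕ} (hc : Monotone c) {b b' : ℕ → ℕ → M} {p q N : ℕ}
    (hpq : p < q) (hq : c (q + 1) ≤ N) (h : ∀ r s, r < s → s < N → b r s = b' r s) :
    blockProd₂ c b p q = blockProd₂ c b' p q := by
  unfold blockProd₂ blockProd
  refine Finset.prod_congr rfl fun r hr => Finset.prod_congr rfl fun s hs => ?_
  rw [Finset.mem_Ico] at hr hs
  exact h r s (hr.2.trans_le ((hc hpq).trans hs.1)) (hs.2.trans_le hq)

theorem blockProd_update {c : ℕ → ℕ} (hc : Monotone c) {p r : ℕ}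
    (hr : r ∈ Finset.Ico (c p) (c (p + 1))) (u : ℕ → M) (x : M) :
    blockProd c (Function.update u r x) = Function.update (blockProd c u) p
      (x * ∏ t ∈ Finset.Ico (c p) (c (p + 1)) \ {r}, u t) := by
  funext p'
  rcases eq_or_ne p' p with rfl | hp
  · rw [Function.update_self, blockProd, Finset.prod_update_of_mem hr]
  · rw [Function.update_of_ne hp, blockProd, Finset.prod_update_of_notMem, blockProd]
    rw [Finset.mem_Ico] at hr ⊢
    rintro ⟨h, h'⟩
    exact hp (le_antisymm (Nat.le_of_lt_succ (hc.reflect_lt (h.trans_lt hr.2)))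
      (Nat.le_of_lt_succ (hc.reflect_lt (hr.1.trans_lt h'))))

theorem exists_blockProd₂_updateEntry {c : ℕ → ℕ} (hc : Monotone c) {p q r s : ℕ}
    (hr : r ∈ Finset.Ico (c p) (c (p + 1))) (hs : s ∈ Finset.Ico (c q) (c (q + 1)))
    (b : ℕ → ℕ → M) :
    ∃ z, ∀ x, blockProd₂ c (updateEntry b r s x) = updateEntry (blockProd₂ c b) p q (x * z) := by
  have hrow (x : M) (q' : ℕ) : (fun r' => blockProd c (updateEntry b r s x r') q') =
      Function.update (fun r' => blockProd c (b r') q') r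
        (blockProd c (Function.update (b r) s x) q') :=
    funext fun r' => Function.apply_update (fun _ u => blockProd c u q') b r _ r'
  refine ⟨(∏ t ∈ Finset.Ico (c q) (c (q + 1)) \ {s}, b r t) *
    ∏ t ∈ Finset.Ico (c p) (c (p + 1)) \ {r}, blockProd c (b t) q,
    fun x => funext fun p' => funext fun q' => ?_⟩
  rw [blockProd₂, hrow, blockProd_update hc hs, updateEntry_apply]
  rcases eq_or_ne q' q with rfl | hq
  · simp [blockProd_update hc hr, Function.update_apply, mul_assoc, blockProd₂]
  · simp [Function.update_eq_self, hq, blockProd₂]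

end Blocks

section PartialComposition

variable {A B : Type*} [CommMonoid B]

variable (A B) in
/-- The `A`-valued functions of a matrix with diagonal `a` in `A` and entries `b i j` in `B`. The
rows and columns are indexed by `ℕ`, so that no casts between arities are needed; a function of
arity `n` only reads the part above the diagonal of the upper left corner of size `n`. -/
abbrev MatrixFun : Type _ := (ℕ → A) → (ℕ → ℕ → B) → A

/-- `F` only reads the part above the diagonal of the upper left corner of size `n`. -/
def DependsOnCorner (n : ℕ) (F : MatrixFun A B) : Prop :=
  ∀ ⦃a a' : ℕ → A⦄ ⦃b b' : ℕ → ℕ → B⦄, (∀ i < n, a i = a' i) →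
    (∀ i j, i < j → j < n → b i j = b' i j) → F a b = F a' b'

/-- The partial composition `F ∘ᵢ G` of the operad of functions of matrices, for `G` of arity `n`:
the diagonal block of size `n` at `i` is replaced by the value of `G` on it. -/
def partialComp (F : MatrixFun A B) (i n : ℕ) (G : MatrixFun A B) : MatrixFun A B := fun a b =>
  F (collapse i n (G (fun j => a (i + j)) fun p q => b (i + p) (i + q)) a)
    (blockProd₂ (cut i n) b)

theorem partialComp_partialComp_of_lt (F G H : MatrixFun A B) {t l : ℕ} (h : t < l) (i s : ℕ) :
    partialComp (partialComp F i l G) (i + t) s H =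
      partialComp F i (l + s - 1) (partialComp G t s H) := by
  have hcut : (fun p => cut (i + t) s (i + p)) = fun p => i + cut t s p := by
    funext p
    grind [cut]
  funext a b
  simp only [partialComp]
  rw [blockProd₂_blockProd₂ (monotone_cut _ _) (monotone_cut _ _), cut_comp_cut_of_lt h,
    collapse_collapse_of_lt h, collapse_shift, blockProd₂_shift, ← hcut]
  simp only [add_assoc]
  rfl

theorem partialComp_partialComp_comm (F G : MatrixFun A B) {H : MatrixFun A B} {m : ℕ}
    (hH : DependsOnCorner m H) {i j : ℕ} (hij : i < j) (n : ℕ) :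
    partialComp (partialComp F j n G) i m H =
      partialComp (partialComp F i m H) (j + m - 1) n G := by
  funext a b
  have hG : (fun p q => blockProd₂ (cut i m) b (j + p) (j + q)) =
      fun p q => b (j + m - 1 + p) (j + m - 1 + q) := by
    funext p q
    rw [blockProd₂_of_succ] <;> grind [cut]
  have hH' (y : A) : H (fun x => collapse (j + m - 1) n y a (i + x))
      (fun p q => blockProd₂ (cut (j + m - 1) n) b (i + p) (i + q)) =
      H (fun x => a (i + x)) fun p q => b (i + p) (i + q) := by
    refine hH (fun x hx => collapse_of_lt (by omega) _ _) fun p q hpq hq => ?_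
    rw [blockProd₂_of_succ] <;> grind [cut]
  simp only [partialComp]
  rw [blockProd₂_blockProd₂ (monotone_cut _ _) (monotone_cut _ _), cut_comp_cut_comm hij,
    collapse_collapse_comm hij, hG, hH',
    blockProd₂_blockProd₂ (monotone_cut _ _) (monotone_cut _ _)]
  congr 4
  funext x
  rw [collapse_of_gt (by omega)]
  congr 1
  omega

theorem dependsOnCorner_partialComp {F G : MatrixFun A B} {m n i : ℕ}
    (hF : DependsOnCorner m F) (hi : i < m) (hG : DependsOnCorner n G) :
    DependsOnCorner (m + n - 1) (partialComp F i n G) := by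
  intro a a' b b' ha hb
  have hGa : G (fun j => a (i + j)) (fun p q => b (i + p) (i + q)) =
      G (fun j => a' (i + j)) fun p q => b' (i + p) (i + q) :=
    hG (fun j hj => ha _ (by omega)) fun p q hpq hq => hb _ _ (by omega) (by omega)
  refine hF (fun j hj => ?_) fun p q hpq hq => ?_
  · grind [collapse]
  · refine blockProd₂_congr (monotone_cut i n) hpq ?_ hb
    rw [← cut_of_lt hi]
    exact monotone_cut i n hq

variable {k : Type*} [Ring k] [AddCommGroup A] [Module k A]

theorem isLinearMap_partialComp_left (i n : ℕ) (G : MatrixFun A B) :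
    IsLinearMap k fun F : MatrixFun A B => partialComp F i n G where
  map_add _ _ := rfl
  map_smul _ _ := rfl

variable (k) in
/-- The composition `F ∘ G` of the pre-Lie structure of the operad, for `F` of arity `m` and `G` of
arity `n`. -/
def preLieComp (m n : ℕ) (F G : MatrixFun A B) : MatrixFun A B :=
  ∑ i ∈ Finset.range m, ((-1 : k) ^ (n + 1)) ^ i • partialComp F i n G

theorem preLieComp_zero_left (m n : ℕ) (G : MatrixFun A B) : preLieComp k m n 0 G = 0 :=
  Finset.sum_eq_zero fun _ _ => smul_zero _

end PartialComposition

section Multilinearity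

variable {k A B : Type*} [CommRing k] [Ring A] [Algebra k A] [CommRing B] [Algebra k B]

variable (k) in
/-- `F` is a cochain of degree `n`, seen as a function of matrices indexed by `ℕ`: it only reads
the corner of size `n`, and is linear in each entry there. -/
structure IsCochainFun (n : ℕ) (F : MatrixFun A B) : Prop where
  dependsOnCorner : DependsOnCorner n F
  linear_left : ∀ a b i, i < n → IsLinearMap k fun x => F (Function.update a i x) b
  linear_right : ∀ a b i j, i < j → j < n → IsLinearMap k fun x => F a (updateEntry b i j x)

theorem isCochainFun_evN {n : ℕ} (f : Cochain k A B n) : IsCochainFun k n (evN f) where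
  dependsOnCorner _ _ _ _ := evN_congr f
  linear_left a b i hi := by
    obtain ⟨L, hL⟩ := (isMultilinear_ev f).left (fun i => a i) (fun p => b p.1.1 p.1.2) ⟨i, hi⟩
    convert L.isLinear using 2 with x
    rw [← hL, evN]
    congr 1
    funext j
    simp [Function.update_apply, Fin.ext_iff]
  linear_right a b i j hij hj := by
    obtain ⟨L, hL⟩ := (isMultilinear_ev f).right (fun i => a i) (fun p => b p.1.1 p.1.2)
      (pr ⟨i, hij.trans hj⟩ ⟨j, hj⟩ hij)
    convert L.isLinear using 2 with x
    rw [← hL, evN]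
    congr 1
    funext p
    simp [Function.update_apply, Subtype.ext_iff, Prod.ext_iff, Fin.ext_iff, updateEntry_apply]

theorem IsCochainFun.exists_evN_eq {n : ℕ} {F : MatrixFun A B} (hF : IsCochainFun k n F) :
    ∃ f : Cochain k A B n, evN f = F := by
  let extA (a : Fin n → A) (i : ℕ) : A := if h : i < n then a ⟨i, h⟩ else 0
  let extB (b : Pair n → B) (i j : ℕ) : B :=
    if h : i < j ∧ j < n then b (pr ⟨i, h.1.trans h.2⟩ ⟨j, h.2⟩ h.1) else 0
  have hM : IsMultilinear k fun (a : Fin n → A) (b : Pair n → B) => F (extA a) (extB b) :=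
    { left := fun a b i => by
        refine ⟨(hF.linear_left (extA a) (extB b) i i.2).mk', fun x => ?_⟩
        refine hF.dependsOnCorner (fun j hj => ?_) fun _ _ _ _ => rfl
        simp [extA, hj, Function.update_apply, Fin.ext_iff]
      right := fun a b r => by
        refine ⟨(hF.linear_right (extA a) (extB b) r.1.1 r.1.2 r.2 r.1.2.2).mk', fun x => ?_⟩
        refine hF.dependsOnCorner (fun _ _ => rfl) fun i j hij hj => ?_
        simp [extB, hij, hj, Function.update_apply, Subtype.ext_iff, Prod.ext_iff, Fin.ext_iff,
          updateEntry_apply] }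
  refine ⟨SecondaryHochschild.mk _ hM, funext fun a => funext fun b => ?_⟩
  rw [evN, ev_mk]
  refine hF.dependsOnCorner (fun i hi => ?_) fun i j hij hj => ?_
  · simp [extA, hi]
  · simp [extB, hij, hj]

end Multilinearity

section Closure

variable {k A B : Type*} [CommRing k] [Ring A] [Algebra k A] [CommRing B] [Algebra k B]
  {m n i : ℕ} {F G : MatrixFun A B}

theorem IsCochainFun.isLinearMap_collapse (hF : IsCochainFun k m F) (hi : i < m) (n : ℕ)
    (a : ℕ → A) (b : ℕ → ℕ → B) : IsLinearMap k fun z => F (collapse i n z a) b := by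
  simpa only [← collapse_eq_update] using hF.linear_left (collapse i n 0 a) b i hi

theorem isLinearMap_partialComp_update (hF : IsCochainFun k m F) (hi : i < m)
    (hG : IsCochainFun k n G) (a : ℕ → A) (b : ℕ → ℕ → B) {r : ℕ} (hr : r < m + n - 1) :
    IsLinearMap k fun x => partialComp F i n G (Function.update a r x) b := by
  by_cases h : i ≤ r ∧ r < i + n
  · have hFL := hF.isLinearMap_collapse hi n a (blockProd₂ (cut i n) b)
    have hGL := hG.linear_left (fun j => a (i + j)) (fun p q => b (i + p) (i + q)) (r - i)
      (by omega)
    convert (hFL.mk' _ ∘ₗ hGL.mk' _).isLinear using 2 with x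
    have hx : (fun j => Function.update a r x (i + j)) =
        Function.update (fun j => a (i + j)) (r - i) x := by
      funext j
      grind [Function.update_apply]
    rw [partialComp, collapse_update_of_mem h.1 h.2, hx]
    rfl
  · obtain ⟨j, hj, hcol⟩ := exists_collapse_update hi hr (by omega)
      (G (fun j => a (i + j)) fun p q => b (i + p) (i + q)) a
    have hx (x : A) := hG.dependsOnCorner
      (fun t ht => Function.update_of_ne (show i + t ≠ r by omega) x a)
      fun p q _ _ => Eq.refl (b (i + p) (i + q))
    simpa only [partialComp, hx, hcol] using
      hF.linear_left (collapse i n _ a) (blockProd₂ (cut i n) b) j hj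

theorem isLinearMap_partialComp_updateEntry (hF : IsCochainFun k m F) (hi : i < m)
    (hG : IsCochainFun k n G) (a : ℕ → A) (b : ℕ → ℕ → B) {r s : ℕ} (hrs : r < s)
    (hs : s < m + n - 1) :
    IsLinearMap k fun x => partialComp F i n G a (updateEntry b r s x) := by
  obtain ⟨p, hp⟩ := exists_cut_le_lt_cut i n r
  obtain ⟨q, hq⟩ := exists_cut_le_lt_cut i n s
  obtain ⟨z, hz⟩ := exists_blockProd₂_updateEntry (monotone_cut i n) (Finset.mem_Ico.2 hp)
    (Finset.mem_Ico.2 hq) b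
  have hpq : p ≤ q := Nat.le_of_lt_succ
    ((monotone_cut i n).reflect_lt (hp.1.trans_lt (hrs.trans hq.2)))
  have hqm : q < m := (monotone_cut i n).reflect_lt (hq.1.trans_lt (by rwa [cut_of_lt hi]))
  rcases hpq.lt_or_eq with hpq | rfl
  · have hFL := hF.linear_right
      (collapse i n (G (fun j => a (i + j)) fun p q => b (i + p) (i + q)) a)
      (blockProd₂ (cut i n) b) p q hpq hqm
    have hx (x : B) := hG.dependsOnCorner (fun t _ => Eq.refl (a (i + t))) fun t u _ _ =>
      show updateEntry b r s x (i + t) (i + u) = b (i + t) (i + u) by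
        rw [updateEntry_apply, if_neg]
        grind [cut]
    simp only [partialComp, hz, hx]
    exact (hFL.mk' _ ∘ₗ LinearMap.mulRight k z).isLinear
  · have hir : i ≤ r ∧ s < i + n := by grind [cut]
    have hFL := hF.isLinearMap_collapse hi n a (blockProd₂ (cut i n) b)
    have hGL := hG.linear_right (fun j => a (i + j)) (fun p q => b (i + p) (i + q)) (r - i) (s - i)
      (by omega) (by omega)
    convert (hFL.mk' _ ∘ₗ hGL.mk' _).isLinear using 2 with x
    have hx : (fun t u => updateEntry b r s x (i + t) (i + u)) =
        updateEntry (fun t u => b (i + t) (i + u)) (r - i) (s - i) x := by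
      funext t u
      grind [updateEntry_apply]
    rw [partialComp, hz, hx]
    refine hF.dependsOnCorner (fun _ _ => rfl) fun t u htu _ => ?_
    rw [updateEntry_apply, if_neg (by omega)]

theorem isCochainFun_partialComp (hF : IsCochainFun k m F) (hi : i < m)
    (hG : IsCochainFun k n G) : IsCochainFun k (m + n - 1) (partialComp F i n G) where
  dependsOnCorner := dependsOnCorner_partialComp hF.dependsOnCorner hi hG.dependsOnCorner
  linear_left a b _ hr := isLinearMap_partialComp_update hF hi hG a b hr
  linear_right a b _ _ hrs hs := isLinearMap_partialComp_updateEntry hF hi hG a b hrs hs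

end Closure

section Multiplication

variable {k A B : Type*} [CommRing k] [Ring A] [Algebra k A] [CommRing B] [Algebra k B]

/-- The multiplication of the operad, the `2`-cochain `ε(b₁₂) a₁ a₂`. -/
def operadMul (ε : B →ₐ[k] A) : MatrixFun A B := fun a b => ε (b 0 1) * a 0 * a 1

/-- The `j`-th face of `F`, of arity `m`: the summands of the differential without their signs. -/
def face (ε : B →ₐ[k] A) (m : ℕ) (F : MatrixFun A B) : ℕ → MatrixFun A B
  | 0 => partialComp (operadMul ε) 1 m F
  | j + 1 => if j < m then partialComp F j 2 (operadMul ε) else partialComp (operadMul ε) 0 m F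

/-- The differential of the operad, on the functions of arity `m`. -/
def delta (ε : B →ₐ[k] A) (m : ℕ) (F : MatrixFun A B) : MatrixFun A B :=
  ∑ j ∈ Finset.range (m + 2), (-1 : k) ^ j • face ε m F j

/-- The cup product of the operad, of functions of arities `m` and `n`. -/
def operadCup (ε : B →ₐ[k] A) (m n : ℕ) (F G : MatrixFun A B) : MatrixFun A B :=
  partialComp (partialComp (operadMul ε) 1 n G) 0 m F

variable (ε : B →ₐ[k] A) {m n i j : ℕ} {F G : MatrixFun A B}

theorem dependsOnCorner_operadMul : DependsOnCorner 2 (operadMul ε) := fun _ _ _ _ ha hb => by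
  unfold operadMul
  rw [ha 0 two_pos, ha 1 one_lt_two, hb 0 1 one_pos one_lt_two]

theorem face_succ (h : j < m) (F : MatrixFun A B) :
    face ε m F (j + 1) = partialComp F j 2 (operadMul ε) := if_pos h

theorem face_last (m : ℕ) (F : MatrixFun A B) :
    face ε m F (m + 1) = partialComp (operadMul ε) 0 m F := if_neg (lt_irrefl m)

theorem face_partialComp_of_le (hi : i < m) (hj : j ≤ i) (n : ℕ) (F G : MatrixFun A B) :
    face ε (m + n - 1) (partialComp F i n G) j = partialComp (face ε m F j) (i + 1) n G := by
  cases j with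
  | zero => rw [face, face, ← partialComp_partialComp_of_lt _ _ _ hi, add_comm 1 i]
  | succ j =>
    rw [face_succ ε (by omega), face_succ ε (by omega),
      partialComp_partialComp_comm _ _ (dependsOnCorner_operadMul ε) hj]
    rfl

theorem face_partialComp_add (hi : i < m) (hj : j < n) (F G : MatrixFun A B) :
    face ε (m + n - 1) (partialComp F i n G) (i + j + 1) =
      partialComp F i (n + 1) (face ε n G (j + 1)) := by
  rw [face_succ ε (by omega), face_succ ε hj, partialComp_partialComp_of_lt _ _ _ hj]
  rfl

theorem face_partialComp_of_ge (hG : DependsOnCorner n G) (hij : i ≤ j) (hj : j < m)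
    (F : MatrixFun A B) :
    face ε (m + n - 1) (partialComp F i n G) (j + n + 1) =
      partialComp (face ε m F (j + 2)) i n G := by
  have hjn : j + 1 + n - 1 = j + n := by omega
  rcases (Nat.succ_le_of_lt hj).lt_or_eq with hj | rfl
  · rw [face_succ ε hj, partialComp_partialComp_comm _ _ hG (Nat.lt_succ_of_le hij), hjn,
      face_succ ε (by omega)]
  · rw [face_last, hjn, face_last, ← hjn,
      ← partialComp_partialComp_of_lt _ _ _ (Nat.lt_succ_of_le hij), zero_add]

theorem partialComp_face_zero (hi : i < m) (n : ℕ) (F G : MatrixFun A B) :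
    partialComp F i (n + 1) (face ε n G 0) = partialComp (face ε m F (i + 1)) (i + 1) n G := by
  rw [face_succ ε hi, partialComp_partialComp_of_lt _ _ _ one_lt_two, face,
    show 2 + n - 1 = n + 1 by omega]

theorem partialComp_face_last (hi : i < m) (n : ℕ) (F G : MatrixFun A B) :
    partialComp F i (n + 1) (face ε n G (n + 1)) = partialComp (face ε m F (i + 1)) i n G := by
  have h := partialComp_partialComp_of_lt F (operadMul ε) G two_pos i n
  rw [add_zero, show 2 + n - 1 = n + 1 by omega] at h
  rw [face_succ ε hi, h, face_last]

theorem partialComp_face_zero_zero (m n : ℕ) (F G : MatrixFun A B) :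
    partialComp (face ε m F 0) 0 n G = operadCup ε n m G F := rfl

theorem partialComp_face_last_last (hF : DependsOnCorner m F) (n : ℕ) (G : MatrixFun A B) :
    partialComp (face ε m F (m + 1)) m n G = operadCup ε m n F G := by
  rw [operadCup, partialComp_partialComp_comm _ _ hF one_pos, face_last, Nat.add_sub_cancel_left]

theorem mergeN_mul (i : ℕ) (u : ℕ → B) : mergeN (· * ·) i u = blockProd (cut i 2) u := by
  funext p
  rcases lt_trichotomy p i with h | rfl | h
  · simp [mergeN, blockProd, cut, h, h.le, Nat.succ_le_of_lt h]
  · simp [mergeN, blockProd, cut, Finset.prod_Ico_succ_top]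
  · rw [mergeN_of_gt _ _ h, blockProd, cut_of_lt h, cut_of_lt (by omega)]
    simp

theorem mergeN₂_eq (i : ℕ) (b : ℕ → ℕ → B) : mergeN₂ i b = blockProd₂ (cut i 2) b := by
  funext p q
  simp only [mergeN₂, blockProd₂, mergeN_mul]

theorem partialComp_operadMul_zero (m : ℕ) (F : MatrixFun A B) (a : ℕ → A) (b : ℕ → ℕ → B) :
    partialComp (operadMul ε) 0 m F a b = ε (∏ i ∈ Finset.range m, b i m) * F a b * a m := by
  rw [partialComp, operadMul, collapse_self, collapse_of_gt one_pos, Nat.add_sub_cancel_left,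
    ← zero_add 1, blockProd₂_cut_zero_succ]
  simp only [zero_add, add_zero]

theorem partialComp_operadMul_one (n : ℕ) (G : MatrixFun A B) (a : ℕ → A) (b : ℕ → ℕ → B) :
    partialComp (operadMul ε) 1 n G a b = ε (∏ j ∈ Finset.range n, b 0 (j + 1)) * a 0 *
      G (fun j => a (j + 1)) fun p q => b (p + 1) (q + 1) := by
  rw [partialComp, operadMul, blockProd₂, blockProd_of_succ rfl, blockProd_cut_self,
    cut_of_le zero_le_one, collapse_of_lt one_pos, collapse_self]
  simp only [add_comm 1]

theorem operadCup_apply (m n : ℕ) (F G : MatrixFun A B) (a : ℕ → A) (b : ℕ → ℕ → B) :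
    operadCup ε m n F G a b =
      ε (∏ i ∈ Finset.range m, ∏ j ∈ Finset.range n, b i (m + j)) * F a b *
        G (fun j => a (m + j)) fun p q => b (m + p) (m + q) := by
  have hm (j : ℕ) : j + 1 + m - 1 = m + j := by omega
  have hG : (fun p q => blockProd₂ (cut 0 m) b (p + 1) (q + 1)) =
      fun p q => b (m + p) (m + q) := by
    funext p q
    rw [blockProd₂_of_succ] <;> grind [cut]
  rw [operadCup, partialComp, partialComp_operadMul_one, Finset.prod_comm, hG, collapse_self]
  simp only [blockProd₂_cut_zero_succ, collapse_of_gt (Nat.succ_pos _), hm, zero_add]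

theorem evN_cupC (hε : ∀ x, ε x ∈ Subalgebra.center k A) (f : Cochain k A B m)
    (g : Cochain k A B n) : evN (cupC ε m n f g) = operadCup ε m n (evN f) (evN g) := by
  funext a b
  rw [evN_cup, operadCup_apply, ← Subalgebra.mem_center_iff.1 (hε _)]

theorem evN_d_eq_delta (hε : ∀ x, ε x ∈ Subalgebra.center k A) (f : Cochain k A B m) :
    evN (d ε m f) = delta ε m (evN f) := by
  have comm (x : B) (y : A) : y * ε x = ε x * y := Subalgebra.mem_center_iff.1 (hε x) y
  have hface (j : ℕ) (hj : j ∈ Finset.range m) (a : ℕ → A) (b : ℕ → ℕ → B) :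
      face ε m (evN f) (j + 1) a b =
        evN f (mergeN (fun x y => ε (b j (j + 1)) * x * y) j a) (mergeN₂ j b) := by
    rw [face_succ ε (Finset.mem_range.1 hj), mergeN₂_eq]
    rfl
  funext a b
  rw [evN_d, delta, Finset.sum_range_succ, Finset.sum_range_succ', face_last, face]
  simp only [Pi.add_apply, Pi.smul_apply, Finset.sum_apply, partialComp_operadMul_zero,
    partialComp_operadMul_one, pow_zero, one_smul, comm]
  rw [Finset.sum_congr rfl fun j hj => congrArg _ (hface j hj a b),
    add_comm (Finset.sum _ _), mul_assoc (ε _) (evN f a b)]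

end Multiplication

section Gerstenhaber

variable {k A B : Type*} [CommRing k] [Ring A] [Algebra k A] [CommRing B] [Algebra k B]

theorem map_sum_smul_of_isLinearMap {ι R M N : Type*} [Semiring R] [AddCommMonoid M] [Module R M]
    [AddCommMonoid N] [Module R N] {L : M → N} (hL : IsLinearMap R L) (s : Finset ι) (c : ι → R)
    (v : ι → M) : L (∑ i ∈ s, c i • v i) = ∑ i ∈ s, c i • L (v i) := by
  rw [← hL.mk'_apply, map_sum]
  exact Finset.sum_congr rfl fun i _ => hL.map_smul (c i) (v i)

theorem isLinearMap_partialComp_right {m i : ℕ} {F : MatrixFun A B} (hF : IsCochainFun k m F)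
    (hi : i < m) (n : ℕ) : IsLinearMap k (partialComp F i n) where
  map_add _ _ := funext fun _ => funext fun _ => (hF.isLinearMap_collapse hi n _ _).map_add _ _
  map_smul _ _ := funext fun _ => funext fun _ => (hF.isLinearMap_collapse hi n _ _).map_smul _ _

variable (ε : B →ₐ[k] A) {m n i : ℕ} {F G : MatrixFun A B}

theorem isCochainFun_operadMul : IsCochainFun k 2 (operadMul ε) where
  dependsOnCorner := dependsOnCorner_operadMul ε
  linear_left a b i hi := by
    interval_cases i <;> constructor <;> simp [operadMul, mul_add, add_mul]
  linear_right a b i j hij hj := by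
    obtain ⟨rfl, rfl⟩ : i = 0 ∧ j = 1 := by omega
    constructor <;> simp [operadMul, updateEntry_apply, add_mul]

theorem isLinearMap_face (m j : ℕ) : IsLinearMap k fun F => face ε m F j := by
  have hμ := isCochainFun_operadMul ε
  cases j with
  | zero => exact isLinearMap_partialComp_right hμ one_lt_two m
  | succ j =>
    by_cases h : j < m
    · simpa only [face, if_pos h] using isLinearMap_partialComp_left j 2 (operadMul ε)
    · simpa only [face, if_neg h] using isLinearMap_partialComp_right hμ two_pos m

theorem isLinearMap_delta (m : ℕ) : IsLinearMap k (delta ε m) where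
  map_add F G := by
    simp only [delta, (isLinearMap_face ε m _).map_add, smul_add, Finset.sum_add_distrib]
  map_smul c F := by
    simp only [delta, (isLinearMap_face ε m _).map_smul, smul_comm _ c, Finset.smul_sum]

/-- The first `i + 1` summands of the expansion of `δF ∘ᵢ G`. Their signed differences in `i`
account for the part of `δ(F ∘ᵢ G)` that involves neither `δF` nor `δG`. -/
def partialFaceSum (m n : ℕ) (F G : MatrixFun A B) (i : ℕ) : MatrixFun A B :=
  ∑ j ∈ Finset.range (i + 1), (-1 : k) ^ j • partialComp (face ε m F j) i n G

theorem partialComp_delta (hF : IsCochainFun k m F) (hi : i < m) (n : ℕ) (G : MatrixFun A B) :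
    partialComp F i (n + 1) (delta ε n G) = partialComp (face ε m F (i + 1)) (i + 1) n G -
      ∑ j ∈ Finset.range n, (-1 : k) ^ j • partialComp F i (n + 1) (face ε n G (j + 1)) +
      (-1 : k) ^ (n + 1) • partialComp (face ε m F (i + 1)) i n G := by
  rw [delta, map_sum_smul_of_isLinearMap (isLinearMap_partialComp_right hF hi _),
    Finset.sum_range_succ, Finset.sum_range_succ', partialComp_face_zero ε hi,
    partialComp_face_last ε hi]
  simp only [pow_succ, mul_neg_one, neg_smul, Finset.sum_neg_distrib, pow_zero, one_smul]
  abel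

theorem partialComp_delta_left (hi : i < m) (n : ℕ) (F G : MatrixFun A B) :
    partialComp (delta ε m F) i n G = partialFaceSum ε m n F G i +
      (-1 : k) ^ (i + 1) • partialComp (face ε m F (i + 1)) i n G +
      (-1 : k) ^ i •
        ∑ j ∈ Finset.range (m - i), (-1 : k) ^ j • partialComp (face ε m F (i + j + 2)) i n G := by
  rw [delta, map_sum_smul_of_isLinearMap (isLinearMap_partialComp_left i n G),
    show m + 2 = i + 1 + 1 + (m - i) by omega, Finset.sum_range_add, Finset.sum_range_succ,
    partialFaceSum, Finset.smul_sum]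
  congr 1
  refine Finset.sum_congr rfl fun j _ => ?_
  rw [smul_smul, ← pow_add, show i + 1 + 1 + j = i + j + 2 by omega, pow_add _ _ 2,
    neg_one_sq, mul_one]

theorem delta_partialComp_eq_sum (hG : DependsOnCorner n G) (hi : i < m) (F : MatrixFun A B) :
    delta ε (m + n - 1) (partialComp F i n G) =
      ∑ j ∈ Finset.range (i + 1), (-1 : k) ^ j • partialComp (face ε m F j) (i + 1) n G +
      (-1 : k) ^ (i + 1) •
        ∑ j ∈ Finset.range n, (-1 : k) ^ j • partialComp F i (n + 1) (face ε n G (j + 1)) +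
      (-1 : k) ^ (i + n + 1) •
        ∑ j ∈ Finset.range (m - i), (-1 : k) ^ j • partialComp (face ε m F (i + j + 2)) i n G := by
  rw [delta, show m + n - 1 + 2 = i + 1 + n + (m - i) by omega, Finset.sum_range_add,
    Finset.sum_range_add, Finset.smul_sum, Finset.smul_sum]
  refine congrArg₂ (· + ·) (congrArg₂ (· + ·) ?_ ?_) ?_ <;>
    refine Finset.sum_congr rfl fun j hj => ?_
  · rw [face_partialComp_of_le ε hi (Finset.mem_range_succ_iff.1 hj)]
  · rw [smul_smul, ← pow_add, ← face_partialComp_add ε hi (Finset.mem_range.1 hj),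
      add_right_comm i j 1]
  · rw [Finset.mem_range] at hj
    rw [smul_smul, ← pow_add, ← face_partialComp_of_ge ε hG (i.le_add_right j) (by omega),
      add_right_comm i 1 n, show i + j + n + 1 = i + n + 1 + j by omega]

theorem delta_partialComp (hF : IsCochainFun k m F) (hG : DependsOnCorner n G) (hi : i < m) :
    delta ε (m + n - 1) (partialComp F i n G) =
      partialFaceSum ε m n F G (i + 1) - (-1 : k) ^ (n + 1) • partialFaceSum ε m n F G i +
      (-1 : k) ^ i • partialComp F i (n + 1) (delta ε n G) +
      (-1 : k) ^ (n + 1) • partialComp (delta ε m F) i n G := by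
  rw [delta_partialComp_eq_sum ε hG hi, partialComp_delta ε hF hi, partialComp_delta_left ε hi,
    partialFaceSum.eq_def ε m n F G (i + 1), Finset.sum_range_succ _ (i + 1)]
  simp only [pow_succ, pow_add]
  module

theorem partialFaceSum_zero (m n : ℕ) (F G : MatrixFun A B) :
    partialFaceSum ε m n F G 0 = operadCup ε n m G F := by
  rw [partialFaceSum, Finset.sum_range_one, pow_zero, one_smul, partialComp_face_zero_zero]

theorem partialFaceSum_self (hF : DependsOnCorner m F) (n : ℕ) (G : MatrixFun A B) :
    partialFaceSum ε m n F G m =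
      partialComp (delta ε m F) m n G + (-1 : k) ^ m • operadCup ε m n F G := by
  rw [delta, map_sum_smul_of_isLinearMap (isLinearMap_partialComp_left m n G),
    Finset.sum_range_succ _ (m + 1), partialComp_face_last_last ε hF, partialFaceSum,
    pow_succ]
  module

theorem preLieComp_zero_right (hF : IsCochainFun k m F) (n : ℕ) :
    preLieComp k m n F 0 = 0 :=
  Finset.sum_eq_zero fun i hi => by
    rw [(isLinearMap_partialComp_right hF (Finset.mem_range.1 hi) n).map_zero, smul_zero]

theorem sum_pow_smul_sub {M : Type*} [AddCommGroup M] [Module k M] {e : k} (he : e * e = 1)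
    (U : ℕ → M) (m : ℕ) :
    ∑ i ∈ Finset.range m, e ^ i • (U (i + 1) - e • U i) = e • (e ^ m • U m - U 0) := by
  have h := Finset.sum_range_sub (fun i => e ^ i • U i) m
  rw [pow_zero, one_smul] at h
  rw [← h, Finset.smul_sum]
  refine Finset.sum_congr rfl fun i _ => ?_
  rw [smul_sub, smul_sub, smul_smul, smul_smul, smul_smul,
    show e * e ^ (i + 1) = e ^ i by rw [pow_succ', ← mul_assoc, he, one_mul], mul_comm]

theorem delta_preLieComp (hF : IsCochainFun k m F) (hG : DependsOnCorner n G) :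
    delta ε (m + n - 1) (preLieComp k m n F G) =
      preLieComp k m (n + 1) F (delta ε n G) +
      (-1 : k) ^ (n + 1) • preLieComp k (m + 1) n (delta ε m F) G +
      (-1 : k) ^ (n + 1) • ((-1 : k) ^ (m * n) • operadCup ε m n F G - operadCup ε n m G F) := by
  have hsq : (-1 : k) ^ (n + 1) * (-1) ^ (n + 1) = 1 := by rw [← mul_pow]; simp
  have hsign (l : ℕ) : ((-1 : k) ^ (n + 1)) ^ l * (-1) ^ l = ((-1) ^ (n + 2)) ^ l := by
    rw [← mul_pow, ← pow_succ]
  have hm : ((-1 : k) ^ (n + 2)) ^ m = (-1) ^ (m * n) := by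
    rw [pow_add, neg_one_sq, mul_one, ← pow_mul, mul_comm]
  rw [preLieComp, map_sum_smul_of_isLinearMap (isLinearMap_delta ε _),
    Finset.sum_congr rfl fun i hi => congrArg _
      (delta_partialComp ε hF hG (Finset.mem_range.1 hi))]
  simp only [smul_add, Finset.sum_add_distrib]
  rw [sum_pow_smul_sub hsq, partialFaceSum_zero, partialFaceSum_self ε hF.dependsOnCorner,
    preLieComp, preLieComp, Finset.sum_range_succ]
  simp only [smul_smul _ _ (partialComp F _ _ _), hsign]
  rw [smul_add (_ ^ m), smul_smul (_ ^ m), hsign, hm, smul_add, Finset.smul_sum]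
  simp only [smul_comm ((-1 : k) ^ (n + 1))]
  module

end Gerstenhaber

section GradedCommutativity

variable {k A B : Type*} [CommRing k] [Ring A] [Algebra k A] [CommRing B] [Algebra k B]

variable (k A B) in
/-- The embedding of the cochains of degree `n` into the functions of matrices indexed by `ℕ`. -/
def evLinear (n : ℕ) : Cochain k A B n →ₗ[k] MatrixFun A B where
  toFun := evN
  map_add' f g := funext fun a => funext fun b => evN_add f g a b
  map_smul' c f := funext fun a => funext fun b => evN_smul c f a b

variable (ε : B →ₐ[k] A) {m n : ℕ}

theorem delta_evN_of_mem_cocycles (hε : ∀ x, ε x ∈ Subalgebra.center k A) {f : Cochain k A B m}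
    (hf : f ∈ cocycles ε m) : delta ε m (evN f) = 0 := by
  rw [← evN_d_eq_delta ε hε, LinearMap.mem_ker.1 hf]
  exact map_zero (evLinear k A B (m + 1))

theorem delta_evN_mem_map_coboundaries (hε : ∀ x, ε x ∈ Subalgebra.center k A) (h : m + 1 = n)
    (f : Cochain k A B m) : delta ε m (evN f) ∈ (coboundaries ε n).map (evLinear k A B n) := by
  subst h
  exact ⟨d ε m f, LinearMap.mem_range_self _ _, evN_d_eq_delta ε hε f⟩

theorem delta_preLieComp_mem_map_coboundaries (hε : ∀ x, ε x ∈ Subalgebra.center k A)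
    (f : Cochain k A B m) (g : Cochain k A B n) :
    delta ε (m + n - 1) (preLieComp k m n (evN f) (evN g)) ∈
      (coboundaries ε (m + n)).map (evLinear k A B (m + n)) := by
  rw [preLieComp, map_sum_smul_of_isLinearMap (isLinearMap_delta ε _)]
  refine Submodule.sum_mem _ fun i hi => Submodule.smul_mem _ _ ?_
  rw [Finset.mem_range] at hi
  obtain ⟨h, hh⟩ := (isCochainFun_partialComp (isCochainFun_evN f) hi
    (isCochainFun_evN g)).exists_evN_eq
  rw [← hh]
  exact delta_evN_mem_map_coboundaries ε hε (by omega) h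

theorem evN_cupC_sub_mem_map_coboundaries (hε : ∀ x, ε x ∈ Subalgebra.center k A)
    {f : Cochain k A B m} {g : Cochain k A B n} (hf : f ∈ cocycles ε m) (hg : g ∈ cocycles ε n) :
    evN (cupC ε m n f g) - (-1 : k) ^ (m * n) • evN (cupC ε n m g f) ∈
      (coboundaries ε (m + n)).map (evLinear k A B (m + n)) := by
  have hsq (l : ℕ) : (-1 : k) ^ l * (-1) ^ l = 1 := by rw [← mul_pow]; simp
  have hf' := isCochainFun_evN f
  have homotopy := delta_preLieComp ε hf' (isCochainFun_evN g).dependsOnCorner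
  rw [delta_evN_of_mem_cocycles ε hε hf, delta_evN_of_mem_cocycles ε hε hg, preLieComp_zero_left,
    preLieComp_zero_right hf', smul_zero, add_zero, zero_add, ← evN_cupC ε hε,
    ← evN_cupC ε hε] at homotopy
  have hmem := Submodule.smul_mem _ ((-1 : k) ^ (n + 1) * (-1) ^ (m * n))
    (delta_preLieComp_mem_map_coboundaries ε hε f g)
  rwa [homotopy, smul_smul, mul_right_comm, hsq, one_mul, smul_sub, smul_smul, hsq,
    one_smul] at hmem

theorem lof_cls_eq_of_evN_sub_mem {M N : ℕ} (hMN : M = N) {x : cocycles ε M} {y : cocycles ε N}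
    (h : evN x.1 - evN y.1 ∈ (coboundaries ε M).map (evLinear k A B M)) :
    DirectSum.lof k ℕ (Cohomology ε) M (cls ε M x) =
      DirectSum.lof k ℕ (Cohomology ε) N (cls ε N y) := by
  subst hMN
  obtain ⟨z, hz, hzxy⟩ := h
  obtain rfl : z = x.1 - y.1 := evN_ext fun a b => congrFun (congrFun hzxy a) b
  exact congrArg _ ((Submodule.Quotient.eq _).2 hz)

end GradedCommutativity

end SecondaryHochschild

end

open SecondaryHochschild in
theorem mainTheorem4_general {k A B : Type*} [CommRing k] [Ring A] [Algebra k A] [CommRing B]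
    [Algebra k B] (ε : B →ₐ[k] A) (hε : ∀ b, ε b ∈ Subalgebra.center k A) (m n : ℕ)
    (x : Cohomology ε m) (y : Cohomology ε n) :
    cup ε hε (DirectSum.lof k ℕ (Cohomology ε) m x) (DirectSum.lof k ℕ (Cohomology ε) n y) =
      (-1 : k) ^ (m * n) • cup ε hε (DirectSum.lof k ℕ (Cohomology ε) n y)
        (DirectSum.lof k ℕ (Cohomology ε) m x) := by
  obtain ⟨f, rfl⟩ := Submodule.Quotient.mk_surjective _ x
  obtain ⟨g, rfl⟩ := Submodule.Quotient.mk_surjective _ y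
  change cup ε hε (DirectSum.lof k ℕ _ m (cls ε m f)) (DirectSum.lof k ℕ _ n (cls ε n g)) =
    _ • cup ε hε (DirectSum.lof k ℕ _ n (cls ε n g)) (DirectSum.lof k ℕ _ m (cls ε m f))
  rw [cup_lof, cup_lof, cupH_cls, cupH_cls, ← map_smul, ← map_smul]
  exact lof_cls_eq_of_evN_sub_mem ε (add_comm m n)
    (evN_cupC_sub_mem_map_coboundaries ε hε f.2 g.2)

theorem mainTheorem4 {k A B : Type*} [Field k] [Ring A] [Algebra k A] [CommRing B] [Algebra k B]
    (ε : B →ₐ[k] A) (hε : ∀ b, ε b ∈ Subalgebra.center k A) (m n : ℕ)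
    (x : SecondaryHochschild.Cohomology ε m) (y : SecondaryHochschild.Cohomology ε n) :
    SecondaryHochschild.cup ε hε
        (DirectSum.lof k ℕ (SecondaryHochschild.Cohomology ε) m x)
        (DirectSum.lof k ℕ (SecondaryHochschild.Cohomology ε) n y) =
      (-1 : k) ^ (m * n) •
        SecondaryHochschild.cup ε hε
          (DirectSum.lof k ℕ (SecondaryHochschild.Cohomology ε) n y)
          (DirectSum.lof k ℕ (SecondaryHochschild.Cohomology ε) m x) :=
  mainTheorem4_general ε hε m n x y
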